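/- Let $\mathbf k$ be a field of characteristic zero and let $V=V_0\oplus V_1$ be a $\mathbb Z/2$-graded vector space over $\mathbf k$ with $\dim V_0=l$, $\dim V_1=n$ (both finite), with an odd differential $d$, $d^2=0$. Let $\hat S\Pi V^*=\mathbf k[[y_1,\dots,y_n]]\otimes\Lambda(x_1,\dots,x_l)$ be the algebra of formal functions on $\Pi V$, where $x_1,\dots,x_l$ (odd) and $y_1,\dots,y_n$ (even) form the basis of $\Pi V^*$ dual to chosen bases of $V_0$ and $V_1$. Write $\hat S_{\ge p}\Pi V^*$ for the functions all of whose monomials have length at least $p$, $\mathrm{Der}_{\ge p}$ for the superderivations of $\hat S\Pi V^*$ that map $\Pi V^*$ into $\hat S_{\ge p}\Pi V^*$, and $D$ for the odd linear vector field induced by $d$. For a homogeneous vector field $\xi$ put $\nabla\xi=\sum_z(-1)^{|\xi(z)||z|}\partial_z(\xi(z))$, the sum over all coordinates $z\in\{x_1,\dots,x_l,y_1,\dots,y_n\}$, with left partial derivatives. Let $\mathfrak g[\Pi V]=\mathrm{Der}_{\ge 2}\ltimes\Pi\hat S_{\ge 1}\Pi V^*$ be the pronilpotent differential graded Lie algebra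 with bracket $$[(\xi,\Pi f),(\eta,\Pi g)]=\bigl([\xi,\eta],\ \Pi(\xi(g)-(-1)^{ij}\eta(f))\bigr)$$ on elements of parities $i,j$ (where $\Pi f$ has parity $|f|+1$) and differential $$\partial(\xi,\Pi f)=\bigl([D,\xi],\ \Pi(D(f)-(-1)^{i}\tfrac12\nabla\xi)\bigr)$$ on elements of parity $i$. A unimodular $L_\infty$ structure on $V$ is a Maurer–Cartan element of $\mathfrak g[\Pi V]$, that is, a pair $(m,f)$ of an odd $m\in\mathrm{Der}_{\ge 2}$ and an even $f\in\hat S_{\ge1}\Pi V^*$ with $$[D,m]+\tfrac12[m,m]=0,\qquad D(f)+\tfrac12\nabla m+m(f)=0.$$ It is strictly unimodular if $f=0$. Two such structures $x,x'$ are equivalent if they are gauge equivalent in $\mathfrak g[\Pi V]$: there is an even $y\in\mathfrak g[\Pi V]$ with $$x'=x+\sum_{r\ge1}\tfrac1{r!}\,\mathrm{ad}(y)^{r-1}\bigl(\mathrm{ad}(y)x-\partial y\bigr),$$ the series converging for the filtration $F_p=\mathrm{Der}_{\ge p+1}\ltimes\Pi\hat S_{\ge p}\Pi V^*$. Theorem.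 Let $(m,f)$ be a unimodular $L_\infty$ structure on $V$. 1. If $n>0$ or $l$ is odd, then $(m,f)$ is equivalent to a strictly unimodular $L_\infty$ structure $(m',0)$ on $V$. 2. If $n=0$ and $l$ is even, then $(m,f)$ is equivalent to a unimodular $L_\infty$ structure of the form $(m',c\cdot x_1\cdots x_l)$, where $c\in\mathbf k$ and $(m',0)$ is itself a (strictly) unimodular $L_\infty$ structure on $V$. -/

import Mathlib

/-! Throughout, `k` is a field of characteristic zero and `V = V₀ ⊕ V₁` is a super vector space with
even part `V₀` of dimension `l` and odd part `V₁` of dimension `n`. Bases of `V₀` and `V₁` give dual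
coordinates on `ΠV`: odd coordinates `x_1, …, x_l` (dual to the basis of `V₀`) and even coordinates
`y_1, …, y_n` (dual to the basis of `V₁`). -/

namespace UnimodularLInfty

noncomputable section

/-- The exterior algebra `Λ(x_1, …, x_l)`. -/
abbrev Ext (k : Type*) [Field k] (l : ℕ) : Type _ := ExteriorAlgebra k (Fin l → k)

/-- The algebra `Ŝ(ΠV*) = k[[y_1, …, y_n]] ⊗ Λ(x_1, …, x_l)` of formal functions on `ΠV`, as power
series in the commuting variables `y_j` with coefficients in the exterior algebra on the `x_i`. -/
abbrev FormalFun (k : Type*) [Field k] (l n : ℕ) : Type _ := MvPowerSeries (Fin n) (Ext k l)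

section Functions

variable {k : Type*} [Field k] {l n : ℕ}

/-- The odd coordinate `x_i`. -/
def oddCoord (i : Fin l) : FormalFun k l n :=
  MvPowerSeries.C (ExteriorAlgebra.ι k (Pi.single i (1 : k)))

/-- The even coordinate `y_j`. -/
def evenCoord (j : Fin n) : FormalFun k l n := MvPowerSeries.X j

/-- The product `x_1 ⋯ x_l` of all the odd coordinates, in this order. -/
def topMonomial (k : Type*) [Field k] (l n : ℕ) : FormalFun k l n :=
  (List.ofFn fun i : Fin l => (oddCoord i : FormalFun k l n)).prod

/-- The sign `(-1)^i` of a parity `i`. -/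
def sgn (k : Type*) [Field k] (i : ZMod 2) : k := (-1) ^ i.val

/-- The formal functions of parity `i`; the `y_j` are even and the `x_i` are odd. -/
def parityPart (k : Type*) [Field k] (l n : ℕ) (i : ZMod 2) : Submodule k (FormalFun k l n) where
  carrier := {a | ∀ e : Fin n →₀ ℕ,
    MvPowerSeries.coeff e a ∈ CliffordAlgebra.evenOdd (0 : QuadraticForm k (Fin l → k)) i}
  add_mem' := fun ha hb e => by rw [map_add]; exact Submodule.add_mem _ (ha e) (hb e)
  zero_mem' := fun e => by rw [map_zero]; exact Submodule.zero_mem _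
  smul_mem' := fun c a ha e => Submodule.smul_mem _ c (ha e)

/-- `Ŝ_{≥ p}(ΠV*)`: the formal functions all of whose monomials (in the `x_i` and `y_j` together)
have length at least `p`. -/
def lengthGE (k : Type*) [Field k] (l n : ℕ) (p : ℕ) : Submodule k (FormalFun k l n) where
  carrier := {a | ∀ e : Fin n →₀ ℕ,
    MvPowerSeries.coeff e a ∈ ⨆ r : {r : ℕ // p ≤ e.degree + r}, ⋀[k]^(r : ℕ) (Fin l → k)}
  add_mem' := fun ha hb e => by rw [map_add]; exact Submodule.add_mem _ (ha e) (hb e)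
  zero_mem' := fun e => by rw [map_zero]; exact Submodule.zero_mem _
  smul_mem' := fun c a ha e => Submodule.smul_mem _ c (ha e)

/-- The partial derivative `∂/∂y_j`. -/
def partialEven (j : Fin n) : Module.End k (FormalFun k l n) where
  toFun a := fun e => ((e j : k) + 1) • MvPowerSeries.coeff (e + Finsupp.single j 1) a
  map_add' a b := by
    ext e
    change ((e j : k) + 1) • MvPowerSeries.coeff (e + Finsupp.single j 1) (a + b) = _
    rw [map_add, smul_add]; rfl
  map_smul' c a := by
    ext e
    exact smul_comm ((e j : k) + 1) c (MvPowerSeries.coeff (e + Finsupp.single j 1) a)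

/-- The (left) partial derivative `∂/∂x_i`: the odd derivation with `∂x_i/∂x_i = 1` that kills the
other coordinates, given on each coefficient by contraction with the `i`-th coordinate form. -/
def partialOdd (i : Fin l) : Module.End k (FormalFun k l n) where
  toFun a := fun e => CliffordAlgebra.contractLeft (Q := (0 : QuadraticForm k (Fin l → k)))
    (LinearMap.proj i : Module.Dual k (Fin l → k)) (MvPowerSeries.coeff e a)
  map_add' a b := by
    ext e
    exact map_add (CliffordAlgebra.contractLeft (Q := (0 : QuadraticForm k (Fin l → k)))
      (LinearMap.proj i : Module.Dual k (Fin l → k))) _ _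
  map_smul' c a := by
    ext e
    exact map_smul (CliffordAlgebra.contractLeft (Q := (0 : QuadraticForm k (Fin l → k)))
      (LinearMap.proj i : Module.Dual k (Fin l → k))) c _

/-- `IsVectorField i p ξ`: `ξ` is an element of parity `i` of `Der_{≥ p}(Ŝ ΠV*)`, that is, a
superderivation of parity `i` of the algebra of formal functions which sends the coordinates to
functions in `Ŝ_{≥ p}(ΠV*)`. (Continuity is automatic: by the Leibniz rule a superderivation maps
`Ŝ_{≥ q+1}` to `Ŝ_{≥ q}`, as there are finitely many coordinates.) -/
structure IsVectorField (i : ZMod 2) (p : ℕ) (ξ : Module.End k (FormalFun k l n)) : Prop where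
  map_parity : ∀ j, ∀ a ∈ parityPart k l n j, ξ a ∈ parityPart k l n (i + j)
  leibniz : ∀ j, ∀ a ∈ parityPart k l n j, ∀ b, ξ (a * b) = ξ a * b + sgn k (i * j) • (a * ξ b)
  map_evenCoord : ∀ j, ξ (evenCoord j) ∈ lengthGE k l n p
  map_oddCoord : ∀ j, ξ (oddCoord j) ∈ lengthGE k l n p

/-- The supercommutator `[ξ, η] = ξη - (-1)^{ij} ηξ` of operators `ξ, η` of parities `i, j`. -/
def superBracket (i j : ZMod 2) (ξ η : Module.End k (FormalFun k l n)) :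
    Module.End k (FormalFun k l n) :=
  ξ * η - sgn k (i * j) • (η * ξ)

/-- The divergence `∇ξ = ∑_z (-1)^{|ξ(z)||z|} ∂_z (ξ(z))`, the sum over all the coordinates `z`, of a
vector field `ξ = ∑_z ξ(z) ∂_z` of parity `i`. For an odd coordinate `z` the sign is
`(-1)^{i + 1}`. -/
def divergence (i : ZMod 2) (ξ : Module.End k (FormalFun k l n)) : FormalFun k l n :=
  ∑ j : Fin n, partialEven j (ξ (evenCoord j)) +
    sgn k (i + 1) • ∑ j : Fin l, partialOdd j (ξ (oddCoord j))

end Functions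

section Differential

variable {k : Type*} [Field k] {V₀ V₁ : Type*} [AddCommGroup V₀] [Module k V₀]
  [AddCommGroup V₁] [Module k V₁] {l n : ℕ}

/-- The linear odd vector field on `ΠV` induced by the odd operator `d = (d₀, d₁)` on `V = V₀ ⊕ V₁`:
it sends a linear coordinate `z` to the linear function `z ∘ d`. -/
def linearField (b₀ : Module.Basis (Fin l) k V₀) (b₁ : Module.Basis (Fin n) k V₁)
    (d₀ : V₀ →ₗ[k] V₁) (d₁ : V₁ →ₗ[k] V₀) : Module.End k (FormalFun k l n) :=
  ∑ j : Fin n,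
      LinearMap.mulLeft k (∑ i : Fin l, b₁.coord j (d₀ (b₀ i)) • (oddCoord i : FormalFun k l n)) *
        partialEven j +
    ∑ i : Fin l,
      LinearMap.mulLeft k (∑ j : Fin n, b₀.coord i (d₁ (b₁ j)) • (evenCoord j : FormalFun k l n)) *
        partialOdd i

end Differential

section DGLA

variable {k : Type*} [Field k] {l n : ℕ}

/-- Underlying pairs `(ξ, Πf)` of the differential graded Lie algebra
`𝔤[ΠV] = Der_{≥ 2}(Ŝ ΠV*) ⋉ Π Ŝ_{≥ 1}(ΠV*)`. -/
abbrev Pair (k : Type*) [Field k] (l n : ℕ) : Type _ :=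
  Module.End k (FormalFun k l n) × FormalFun k l n

/-- `F_p 𝔤[ΠV] = Der_{≥ p+1} ⋉ Π Ŝ_{≥ p}` in parity `i`. An element `Πf` has parity `|f| + 1`.
The elements of `𝔤[ΠV]` of parity `i` are those of `F_1`. -/
def MemFiltration (i : ZMod 2) (p : ℕ) (y : Pair k l n) : Prop :=
  IsVectorField i (p + 1) y.1 ∧ y.2 ∈ parityPart k l n (i + 1) ∧ y.2 ∈ lengthGE k l n p

/-- The Lie bracket of `𝔤[ΠV]`, on elements of parities `i` and `j`:
`[(ξ, Πf), (η, Πg)] = ([ξ, η], Π(ξ(g) - (-1)^{ij} η(f)))`. -/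
def bracket (i j : ZMod 2) (y z : Pair k l n) : Pair k l n :=
  (superBracket i j y.1 z.1, y.1 z.2 - sgn k (i * j) • z.1 y.2)

/-- The total differential of `𝔤[ΠV]` on elements of parity `i`, where `D` is the linear vector field
of the differential of `V`: `(ξ, Πf) ↦ ([D, ξ], Π(D(f) - (-1)^i ½ ∇ξ))`. -/
def differential (D : Module.End k (FormalFun k l n)) (i : ZMod 2) (y : Pair k l n) : Pair k l n :=
  (superBracket 1 i D y.1, D y.2 - sgn k i • (2⁻¹ : k) • divergence i y.1)

/-- `(m, f)` is a unimodular `L_∞` structure on `V`: `m` is an odd element of `Der_{≥ 2}(Ŝ ΠV*)`, `f`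
is an even element of `Ŝ_{≥ 1}(ΠV*)`, and `d(m) + ½[m, m] = 0`, `d(f) + ½ ∇m + m(f) = 0`.
These are the Maurer--Cartan elements of `𝔤[ΠV]`, see `isUnimodular_iff`. -/
structure IsUnimodular (D : Module.End k (FormalFun k l n)) (m : Module.End k (FormalFun k l n))
    (f : FormalFun k l n) : Prop where
  isVectorField : IsVectorField 1 2 m
  even : f ∈ parityPart k l n 0
  lengthGE_one : f ∈ lengthGE k l n 1
  mc_field : superBracket 1 1 D m + (2⁻¹ : k) • superBracket 1 1 m m = 0
  mc_function : D f + (2⁻¹ : k) • divergence 1 m + m f = 0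

theorem isUnimodular_iff [CharZero k] (D m : Module.End k (FormalFun k l n)) (f : FormalFun k l n) :
    IsUnimodular D m f ↔ MemFiltration 1 1 (m, f) ∧
      differential D 1 (m, f) + (2⁻¹ : k) • bracket 1 1 (m, f) (m, f) = 0 := by
  have hs : sgn k (1 : ZMod 2) = -1 := by
    rw [sgn, show (1 : ZMod 2).val = 1 from rfl, pow_one]
  have h2 : (2⁻¹ : k) • (m f - sgn k (1 * 1) • m f) = m f := by
    rw [mul_one, hs, neg_one_smul, sub_neg_eq_add, ← two_smul k, smul_smul,
      inv_mul_cancel₀ two_ne_zero, one_smul]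
  have h3 : differential D 1 (m, f) + (2⁻¹ : k) • bracket 1 1 (m, f) (m, f) =
      (superBracket 1 1 D m + (2⁻¹ : k) • superBracket 1 1 m m,
        D f + (2⁻¹ : k) • divergence 1 m + m f) := by
    refine Prod.ext rfl ?_
    change D f - sgn k 1 • (2⁻¹ : k) • divergence 1 m +
      (2⁻¹ : k) • (m f - sgn k (1 * 1) • m f) = _
    rw [h2, hs, neg_one_smul, sub_neg_eq_add]
  rw [h3, Prod.mk_eq_zero]
  exact ⟨fun h => ⟨⟨h.1, h.2, h.3⟩, h.4, h.5⟩, fun h => ⟨h.1.1, h.1.2.1, h.1.2.2, h.2.1, h.2.2⟩⟩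

/-- The `N`-th partial sum `x + ∑_{1 ≤ r ≤ N} (1/r!) ad(y)^{r-1} (ad(y) x - dy)` of the gauge action
`e^y · x`, for `y` even and `x` odd. -/
def gaugePartialSum (D : Module.End k (FormalFun k l n)) (y x : Pair k l n) (N : ℕ) : Pair k l n :=
  x + ∑ r ∈ Finset.range N, ((r + 1).factorial : k)⁻¹ •
    (bracket 0 1 y)^[r] (bracket 0 1 y x - differential D 0 y)

/-- `x` and `x'` are gauge equivalent in the pronilpotent dgla `𝔤[ΠV]`: there is an even element `y`
of `𝔤[ΠV]` with `e^y · x = x'`, the series converging with respect to the filtration `F_p`. -/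
def GaugeEquiv (D : Module.End k (FormalFun k l n)) (x x' : Pair k l n) : Prop :=
  ∃ y : Pair k l n, MemFiltration 0 1 y ∧
    ∀ p : ℕ, ∀ᶠ N in Filter.atTop, MemFiltration 1 p (x' - gaugePartialSum D y x N)

end DGLA

end

end UnimodularLInfty

/-! Put `Q = D + m`. Then `(m, f)` is a unimodular structure iff `Q² = 0` and `Q f + ½ ∇Q = 0`.
For an even `ξ ∈ Der_{≥ 2}`, the gauge action of `(ξ, 0)` replaces `Q` by `Q' = e^{ad ξ} Q` and
`f` by `f' = f + ∑_{r ≥ 0} ξ^r/(r+1)! (ξ f + ½ ∇ξ)`. Suppose `s` is a right inverse of the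
divergence up to an error `τ`, that is `∇(s u) = u - τ u`, and raises lengths as `∇` lowers them.
For `ξ = s u` the function `∇ξ - 2 f'` is a contraction of `u`, and at its fixed point
`f' = -½ τ u`.

If there is an even coordinate `y`, integration in `y` gives `s u = (∫ u dy) ∂_y` with `τ = 0`. If
there is none, telescoping the relations `1 = x_i ∂_i + ∂_i x_i` gives such an `s` with
`τ = ∏_i x_i ∂_i`, whose image is the line of `x_1 ⋯ x_l`. This line has parity `l`, so `τ` kills
the even functions when `l` is odd; and an odd vector field kills it, because it would have to map
it to itself while changing the parity. -/

namespace UnimodularLInfty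

noncomputable section

section Signs

variable {k : Type*} [Field k]

theorem sgn_zero : sgn k 0 = 1 := by simp [sgn]

theorem sgn_one : sgn k 1 = -1 := by
  rw [sgn, show (1 : ZMod 2).val = 1 from rfl, pow_one]

theorem sgn_add (i j : ZMod 2) : sgn k (i + j) = sgn k i * sgn k j := by
  have h : ∀ i : ZMod 2, i = 0 ∨ i = 1 := by decide
  rcases h i with rfl | rfl <;> rcases h j with rfl | rfl <;>
    simp [sgn_zero, sgn_one, CharTwo.add_self_eq_zero]

theorem sgn_mul_self (i : ZMod 2) : sgn k i * sgn k i = 1 := by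
  rw [← sgn_add, CharTwo.add_self_eq_zero, sgn_zero]

end Signs

section Exterior

open CliffordAlgebra

variable {k M : Type*} [Field k] [AddCommGroup M] [Module k M] {Q : QuadraticForm k M}
  {i j : ZMod 2}

theorem mul_mem_evenOdd {a b : CliffordAlgebra Q} (ha : a ∈ evenOdd Q i) (hb : b ∈ evenOdd Q j) :
    a * b ∈ evenOdd Q (i + j) :=
  evenOdd_mul_le _ _ _ (Submodule.mul_mem_mul ha hb)

/-- Unlike `CliffordAlgebra.evenOdd_induction`, this adds one vector at a time. -/
theorem evenOdd_induction_ι_mul {P : ZMod 2 → CliffordAlgebra Q → Prop} (zero : ∀ i, P i 0)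
    (algebraMap : ∀ c, P 0 (algebraMap k _ c)) (add : ∀ i x y, P i x → P i y → P i (x + y))
    (ι_mul : ∀ v i x, x ∈ evenOdd Q i → P i x → P (1 + i) (ι Q v * x))
    {i : ZMod 2} {a : CliffordAlgebra Q} (ha : a ∈ evenOdd Q i) : P i a := by
  refine Submodule.iSup_induction _ (motive := P i) ha ?_ (zero i) (add i)
  rintro ⟨r, rfl⟩ x hx
  refine Submodule.pow_induction_on_left' _ (C := fun r x _ => P (r : ZMod 2) x)
    (fun c => by simpa using algebraMap c) (fun x y r _ _ => add r x y) ?_ hx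
  rintro _ ⟨v, rfl⟩ r x hx hPx
  rw [Nat.succ_eq_add_one, Nat.cast_add, Nat.cast_one, add_comm]
  exact ι_mul v r x (Submodule.mem_iSup_of_mem ⟨r, rfl⟩ hx) hPx

theorem contractLeft_mem_evenOdd (d : Module.Dual k M) {a : CliffordAlgebra Q}
    (ha : a ∈ evenOdd Q i) : contractLeft d a ∈ evenOdd Q (1 + i) := by
  refine evenOdd_induction_ι_mul (P := fun i a => contractLeft d a ∈ evenOdd Q (1 + i))
    (fun i => by simp) (fun c => by simp) (fun i x y hx hy => ?_) (fun v i x hx hdx => ?_) ha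
  · rw [map_add]; exact add_mem hx hy
  · rw [contractLeft_ι_mul, ← add_assoc, CharTwo.add_self_eq_zero, zero_add]
    refine sub_mem (Submodule.smul_mem _ _ hx) ?_
    simpa [← add_assoc, CharTwo.add_self_eq_zero] using mul_mem_evenOdd (ι_mem_evenOdd_one Q v) hdx

theorem contractLeft_mul (d : Module.Dual k M) {a : CliffordAlgebra Q} (ha : a ∈ evenOdd Q i)
    (b : CliffordAlgebra Q) :
    contractLeft d (a * b) = contractLeft d a * b + sgn k i • (a * contractLeft d b) := by
  refine evenOdd_induction_ι_mul (P := fun i a => contractLeft d (a * b) =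
    contractLeft d a * b + sgn k i • (a * contractLeft d b))
    (fun i => by simp) (fun c => ?_) (fun i x y hx hy => ?_) (fun v i x _ hx => ?_) ha
  · rw [contractLeft_algebraMap_mul, contractLeft_algebraMap, sgn_zero, one_smul, zero_mul,
      zero_add]
  · rw [add_mul, map_add, hx, hy, map_add, add_mul, add_mul, smul_add]; abel
  · rw [mul_assoc, contractLeft_ι_mul, hx, contractLeft_ι_mul, sgn_add, sgn_one, mul_add, sub_mul,
      mul_smul_comm, neg_one_mul, neg_smul, mul_assoc, mul_assoc, smul_mul_assoc]
    abel

theorem ι_mul_eq_sgn_smul {b : ExteriorAlgebra k M} (hb : b ∈ evenOdd (0 : QuadraticForm k M) j)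
    (v : M) : ExteriorAlgebra.ι k v * b = sgn k j • (b * ExteriorAlgebra.ι k v) := by
  refine evenOdd_induction_ι_mul (P := fun j b => ExteriorAlgebra.ι k v * b =
    sgn k j • (b * ExteriorAlgebra.ι k v))
    (fun j => by simp) (fun c => ?_) (fun j x y hx hy => ?_) (fun w j x _ hx => ?_) hb
  · rw [sgn_zero, one_smul, Algebra.commutes]
  · rw [mul_add, add_mul, hx, hy, smul_add]
  · have hvw := eq_neg_of_add_eq_zero_left (ExteriorAlgebra.ι_add_mul_swap (R := k) v w)
    rw [sgn_add, sgn_one, ← mul_assoc, hvw, neg_mul, mul_assoc, hx, mul_smul_comm, neg_one_mul,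
      neg_smul, mul_assoc]

theorem mul_eq_sgn_smul_of_mem_evenOdd {a b : ExteriorAlgebra k M}
    (ha : a ∈ evenOdd (0 : QuadraticForm k M) i) (hb : b ∈ evenOdd (0 : QuadraticForm k M) j) :
    a * b = sgn k (i * j) • (b * a) := by
  refine evenOdd_induction_ι_mul (P := fun i a => a * b = sgn k (i * j) • (b * a))
    (fun i => by simp) (fun c => ?_) (fun i x y hx hy => ?_) (fun w i x _ hx => ?_) ha
  · rw [zero_mul, sgn_zero, one_smul, Algebra.commutes]
  · rw [mul_add, add_mul, hx, hy, smul_add]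
  · rw [mul_assoc, hx, add_mul, one_mul, sgn_add, mul_smul_comm, ← mul_assoc,
      ι_mul_eq_sgn_smul hb w, smul_mul_assoc, smul_smul, mul_assoc, mul_comm (sgn k j)]

/-- The sum of the exterior powers `⋀ʳ M` with `p ≤ r`. -/
def exteriorGE (k M : Type*) [Field k] [AddCommGroup M] [Module k M] (p : ℕ) :
    Submodule k (ExteriorAlgebra k M) :=
  ⨆ r : {r : ℕ // p ≤ r}, ⋀[k]^(r : ℕ) M

variable {p q : ℕ}

theorem exteriorPower_le_exteriorGE (h : p ≤ q) : ⋀[k]^q M ≤ exteriorGE k M p :=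
  le_iSup (fun r : {r : ℕ // p ≤ r} => ⋀[k]^(r : ℕ) M) ⟨q, h⟩

theorem exteriorGE_le {S : Submodule k (ExteriorAlgebra k M)} :
    exteriorGE k M p ≤ S ↔ ∀ r, p ≤ r → ⋀[k]^r M ≤ S := by
  rw [exteriorGE, iSup_le_iff, Subtype.forall]

theorem exteriorGE_anti (h : p ≤ q) : exteriorGE k M q ≤ exteriorGE k M p :=
  exteriorGE_le.mpr fun _ hr => exteriorPower_le_exteriorGE (h.trans hr)

theorem exteriorGE_zero : exteriorGE k M 0 = ⊤ := by
  rw [eq_top_iff, ← iSup_ι_range_eq_top (0 : QuadraticForm k M)]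
  exact iSup_le fun r => exteriorPower_le_exteriorGE (Nat.zero_le r)

theorem exteriorGE_succ_le :
    exteriorGE k M (p + 1) ≤ LinearMap.range (ExteriorAlgebra.ι k) * exteriorGE k M p := by
  refine exteriorGE_le.mpr fun r hr => ?_
  obtain ⟨r, rfl⟩ := Nat.exists_eq_add_of_lt hr
  rw [ExteriorAlgebra.exteriorPower, pow_succ']
  exact mul_le_mul' le_rfl (exteriorPower_le_exteriorGE (Nat.le_add_right p r))

theorem top_le_one_sup_exteriorGE_one : ⊤ ≤ 1 ⊔ exteriorGE k M 1 := by
  rw [← exteriorGE_zero, exteriorGE_le]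
  rintro (_ | r) -
  · exact (pow_zero _).trans_le le_sup_left
  · exact (exteriorPower_le_exteriorGE (Nat.le_add_left 1 r)).trans le_sup_right

theorem exteriorGE_mul_le : exteriorGE k M p * exteriorGE k M q ≤ exteriorGE k M (p + q) := by
  rw [exteriorGE, exteriorGE, Submodule.iSup_mul, iSup_le_iff]
  intro r
  rw [Submodule.mul_iSup, iSup_le_iff]
  intro s
  rw [← pow_add]
  exact exteriorPower_le_exteriorGE (add_le_add r.2 s.2)

theorem ι_mem_exteriorGE_one (v : M) : ExteriorAlgebra.ι k v ∈ exteriorGE k M 1 :=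
  exteriorPower_le_exteriorGE le_rfl (by simp)

theorem exteriorGE_eq_bot [FiniteDimensional k M] (h : Module.finrank k M < p) :
    exteriorGE k M p = ⊥ := by
  refine eq_bot_iff.mpr (exteriorGE_le.mpr fun r hr => ?_)
  rw [le_bot_iff, ← Submodule.finrank_eq_zero, exteriorPower.finrank_eq,
    Nat.choose_eq_zero_of_lt (h.trans_le hr)]

end Exterior

section Functions

variable {k : Type*} [Field k] {l n : ℕ} {i j : ZMod 2} {p q : ℕ} {a b : FormalFun k l n}

open MvPowerSeries (coeff)

theorem coeff_base_smul (e : Fin n →₀ ℕ) (c : k) (a : FormalFun k l n) :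
    coeff e (c • a) = c • coeff e a := rfl

theorem mem_lengthGE_iff :
    a ∈ lengthGE k l n p ↔ ∀ e, coeff e a ∈ exteriorGE k (Fin l → k) (p - e.degree) := by
  simp only [exteriorGE, iSup_subtype, tsub_le_iff_left]
  simp only [← iSup_subtype (p := fun r => p ≤ _ + r) (f := fun r => ⋀[k]^(r : ℕ) (Fin l → k))]
  rfl

theorem mul_mem_parityPart (ha : a ∈ parityPart k l n i) (hb : b ∈ parityPart k l n j) :
    a * b ∈ parityPart k l n (i + j) := fun e => by
  classical
  rw [MvPowerSeries.coeff_mul]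
  exact sum_mem fun x _ => mul_mem_evenOdd (ha x.1) (hb x.2)

theorem mul_eq_sgn_smul (ha : a ∈ parityPart k l n i) (hb : b ∈ parityPart k l n j) :
    a * b = sgn k (i * j) • (b * a) := by
  classical
  ext e
  rw [coeff_base_smul, MvPowerSeries.coeff_mul, MvPowerSeries.coeff_mul, Finset.smul_sum,
    Finsupp.sum_antidiagonal_swap e fun u v => coeff u a * coeff v b]
  exact Finset.sum_congr rfl fun x _ => mul_eq_sgn_smul_of_mem_evenOdd (ha _) (hb _)

theorem lengthGE_anti (h : q ≤ p) : lengthGE k l n p ≤ lengthGE k l n q := fun a ha =>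
  mem_lengthGE_iff.mpr fun e => exteriorGE_anti (by omega) (mem_lengthGE_iff.mp ha e)

theorem mem_lengthGE_zero (a : FormalFun k l n) : a ∈ lengthGE k l n 0 :=
  mem_lengthGE_iff.mpr fun e => by rw [Nat.zero_sub, exteriorGE_zero]; exact Submodule.mem_top

theorem mul_mem_lengthGE (ha : a ∈ lengthGE k l n p) (hb : b ∈ lengthGE k l n q) :
    a * b ∈ lengthGE k l n (p + q) := mem_lengthGE_iff.mpr fun e => by
  classical
  rw [MvPowerSeries.coeff_mul]
  refine sum_mem fun x hx => ?_
  have hdeg : x.1.degree + x.2.degree = e.degree := by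
    rw [← map_add, Finset.HasAntidiagonal.mem_antidiagonal.mp hx]
  exact exteriorGE_anti (by omega) (exteriorGE_mul_le
    (Submodule.mul_mem_mul (mem_lengthGE_iff.mp ha x.1) (mem_lengthGE_iff.mp hb x.2)))

theorem coeff_eq_zero_of_mem_lengthGE (ha : a ∈ lengthGE k l n p) {e : Fin n →₀ ℕ}
    (h : e.degree + l < p) : coeff e a = 0 := by
  have he := mem_lengthGE_iff.mp ha e
  rwa [exteriorGE_eq_bot (by rw [Module.finrank_fin_fun]; omega), Submodule.mem_bot] at he

theorem eq_zero_of_forall_mem_lengthGE (h : ∀ p, a ∈ lengthGE k l n p) : a = 0 := by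
  ext e
  rw [coeff_eq_zero_of_mem_lengthGE (h (e.degree + l + 1)) (Nat.lt_succ_self _), map_zero]

theorem C_mem_parityPart {u : Ext k l}
    (hu : u ∈ CliffordAlgebra.evenOdd (0 : QuadraticForm k (Fin l → k)) i) :
    (MvPowerSeries.C u : FormalFun k l n) ∈ parityPart k l n i := fun e => by
  classical
  rw [MvPowerSeries.coeff_C]
  split_ifs
  exacts [hu, zero_mem _]

theorem C_mem_lengthGE {u : Ext k l} (hu : u ∈ exteriorGE k (Fin l → k) p) :
    (MvPowerSeries.C u : FormalFun k l n) ∈ lengthGE k l n p := mem_lengthGE_iff.mpr fun e => by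
  classical
  rw [MvPowerSeries.coeff_C]
  split_ifs with h
  exacts [exteriorGE_anti (Nat.sub_le _ _) hu, zero_mem _]

theorem coeff_zero_mem_exteriorGE (ha : a ∈ lengthGE k l n p) :
    coeff 0 a ∈ exteriorGE k (Fin l → k) p := by
  simpa using mem_lengthGE_iff.mp ha 0

theorem one_mem_parityPart : (1 : FormalFun k l n) ∈ parityPart k l n 0 := by
  rw [← map_one MvPowerSeries.C]
  exact C_mem_parityPart (Submodule.one_le.mp (CliffordAlgebra.one_le_evenOdd_zero _))

/-- Indices of the coordinates of `ΠV`: those of the `y_j` on the left, those of the `x_i` on the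
right. -/
abbrev CoordIdx (l n : ℕ) : Type := Fin n ⊕ Fin l

/-- The parity of a coordinate. -/
def coordParity : CoordIdx l n → ZMod 2 := Sum.elim (fun _ => 0) fun _ => 1

/-- The coordinate functions `y_j` and `x_i` as one family. -/
def coord (k : Type*) [Field k] : CoordIdx l n → FormalFun k l n := Sum.elim evenCoord oddCoord

theorem evenCoord_mem_parityPart (t : Fin n) : evenCoord t ∈ parityPart k l n 0 := fun e => by
  classical
  rw [evenCoord, MvPowerSeries.coeff_X]
  split_ifs
  exacts [Submodule.one_le.mp (CliffordAlgebra.one_le_evenOdd_zero _), zero_mem _]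

theorem oddCoord_mem_parityPart (t : Fin l) : oddCoord t ∈ parityPart k l n 1 :=
  C_mem_parityPart (CliffordAlgebra.ι_mem_evenOdd_one _ _)

theorem coord_mem_parityPart (z : CoordIdx l n) : coord k z ∈ parityPart k l n (coordParity z) :=
  z.rec evenCoord_mem_parityPart oddCoord_mem_parityPart

theorem evenCoord_mem_lengthGE (t : Fin n) : evenCoord t ∈ lengthGE k l n 1 :=
  mem_lengthGE_iff.mpr fun e => by
    classical
    rw [evenCoord, MvPowerSeries.coeff_X]
    split_ifs with h
    · rw [h, Finsupp.degree_single, Nat.sub_self, exteriorGE_zero]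
      exact Submodule.mem_top
    · exact zero_mem _

theorem oddCoord_mem_lengthGE (t : Fin l) : oddCoord t ∈ lengthGE k l n 1 :=
  C_mem_lengthGE (ι_mem_exteriorGE_one _)

theorem coord_mem_lengthGE (z : CoordIdx l n) : coord k z ∈ lengthGE k l n 1 :=
  z.rec evenCoord_mem_lengthGE oddCoord_mem_lengthGE

theorem coeff_evenCoord_mul_add_single (t : Fin n) (e : Fin n →₀ ℕ) (a : FormalFun k l n) :
    coeff (e + Finsupp.single t 1) (evenCoord t * a) = coeff e a := by
  rw [evenCoord, MvPowerSeries.X_def, add_comm, MvPowerSeries.coeff_add_monomial_mul, one_mul]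

theorem coeff_evenCoord_mul (t : Fin n) (e : Fin n →₀ ℕ) (a : FormalFun k l n) :
    coeff e (evenCoord t * a) = if e t = 0 then 0 else coeff (e - Finsupp.single t 1) a := by
  classical
  simp [evenCoord, MvPowerSeries.X_def, MvPowerSeries.coeff_monomial_mul, Nat.one_le_iff_ne_zero,
    ite_not]

theorem sub_single_add_single {t : Fin n} {e : Fin n →₀ ℕ} (h : e t ≠ 0) :
    e - Finsupp.single t 1 + Finsupp.single t 1 = e :=
  tsub_add_cancel_of_le (Finsupp.single_le_iff.mpr (Nat.one_le_iff_ne_zero.mpr h))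

theorem exists_eq_sum_evenCoord_mul (ha : a ∈ lengthGE k l n (p + 1)) (h0 : coeff 0 a = 0) :
    ∃ b : Fin n → FormalFun k l n,
      (∀ t, b t ∈ lengthGE k l n p) ∧ a = ∑ t, evenCoord t * b t := by
  classical
  -- Each monomial `y^e` is divided by its first variable.
  let b : Fin n → FormalFun k l n := fun t e =>
    if IsLeast ((e + Finsupp.single t 1).support : Set (Fin n)) t then
      coeff (e + Finsupp.single t 1) a else 0
  have coeff_b : ∀ t e, coeff e (b t) =
    if IsLeast ((e + Finsupp.single t 1).support : Set (Fin n)) t then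
      coeff (e + Finsupp.single t 1) a else 0 := fun _ _ => rfl
  refine ⟨b, fun t => mem_lengthGE_iff.mpr fun e => ?_, MvPowerSeries.ext fun e => ?_⟩
  · rw [coeff_b]
    split_ifs
    · exact exteriorGE_anti (by rw [map_add, Finsupp.degree_single]; omega)
        (mem_lengthGE_iff.mp ha _)
    · exact zero_mem _
  · simp only [map_sum, coeff_evenCoord_mul, coeff_b]
    by_cases he : e = 0
    · simp [he, h0]
    have ht := Finset.isLeast_min' e.support (Finsupp.support_nonempty_iff.mpr he)
    set t := e.support.min' (Finsupp.support_nonempty_iff.mpr he)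
    have het : e t ≠ 0 := Finsupp.mem_support_iff.mp ht.1
    rw [Finset.sum_eq_single t]
    · rw [if_neg het, sub_single_add_single het, if_pos ht]
    · intro t' _ htt'
      by_cases het' : e t' = 0
      · rw [if_pos het']
      · rw [if_neg het', sub_single_add_single het', if_neg fun h => htt' (h.unique ht)]
    · exact fun h => absurd (Finset.mem_univ t) h

theorem C_mem_iSup_map_mulLeft {u : Ext k l} (hu : u ∈ exteriorGE k (Fin l → k) (p + 1)) :
    (MvPowerSeries.C u : FormalFun k l n) ∈
      ⨆ t : Fin l, (lengthGE k l n p).map (LinearMap.mulLeft k (oddCoord t)) := by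
  refine Submodule.mul_induction_on (exteriorGE_succ_le hu) ?_ fun x y hx hy => ?_
  · rintro _ ⟨v, rfl⟩ b hb
    have hv : ExteriorAlgebra.ι k v * b =
        ∑ t, ExteriorAlgebra.ι k (Pi.single t (1 : k)) * (v t • b) := by
      conv_lhs => rw [pi_eq_sum_univ' v, map_sum, Finset.sum_mul]
      simp only [map_smul, smul_mul_assoc, mul_smul_comm]
    rw [hv, map_sum]
    refine sum_mem fun t _ => Submodule.mem_iSup_of_mem t
      ⟨MvPowerSeries.C (v t • b), C_mem_lengthGE (Submodule.smul_mem _ _ hb), ?_⟩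
    rw [map_mul]
    rfl
  · rw [map_add]
    exact add_mem hx hy

theorem lengthGE_succ_le : lengthGE k l n (p + 1) ≤
    ⨆ z : CoordIdx l n, (lengthGE k l n p).map (LinearMap.mulLeft k (coord k z)) := fun a ha => by
  have hC := C_mem_lengthGE (n := n) (coeff_zero_mem_exteriorGE ha)
  obtain ⟨b, hb, hab⟩ := exists_eq_sum_evenCoord_mul (sub_mem ha hC) (by simp)
  rw [← sub_add_cancel a (MvPowerSeries.C (coeff 0 a)), hab, iSup_sum]
  exact add_mem
    (Submodule.mem_sup_left (sum_mem fun t _ => Submodule.mem_iSup_of_mem t ⟨b t, hb t, rfl⟩))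
    (Submodule.mem_sup_right (C_mem_iSup_map_mulLeft (coeff_zero_mem_exteriorGE ha)))

theorem exists_sub_smul_one_mem_lengthGE (a : FormalFun k l n) :
    ∃ c : k, a - c • (1 : FormalFun k l n) ∈ lengthGE k l n 1 := by
  classical
  obtain ⟨x, hx, y, hy, hxy⟩ := Submodule.mem_sup.mp
    (top_le_one_sup_exteriorGE_one (Submodule.mem_top : coeff 0 a ∈ ⊤))
  obtain ⟨c, rfl⟩ := Submodule.mem_one.mp hx
  refine ⟨c, mem_lengthGE_iff.mpr fun e => ?_⟩
  rw [map_sub, coeff_base_smul, MvPowerSeries.coeff_one]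
  split_ifs with h
  · rw [h, ← hxy, Algebra.algebraMap_eq_smul_one, add_sub_cancel_left, map_zero]
    exact hy
  · have hdeg : 1 - e.degree = 0 := by
      rw [Nat.sub_eq_zero_iff_le, Nat.one_le_iff_ne_zero, Ne, Finsupp.degree_eq_zero_iff]
      exact h
    rw [hdeg, exteriorGE_zero]
    exact Submodule.mem_top

end Functions

section PartialDerivatives

open MvPowerSeries (coeff)

variable {k : Type*} [Field k] {l n : ℕ}

theorem coeff_partialEven (t : Fin n) (a : FormalFun k l n) (e : Fin n →₀ ℕ) :
    coeff e (partialEven t a) = ((e t : k) + 1) • coeff (e + Finsupp.single t 1) a := rfl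

theorem coeff_partialOdd (t : Fin l) (a : FormalFun k l n) (e : Fin n →₀ ℕ) :
    coeff e (partialOdd t a) = CliffordAlgebra.contractLeft (Q := (0 : QuadraticForm k (Fin l → k)))
      (LinearMap.proj t : Module.Dual k (Fin l → k)) (coeff e a) := rfl

theorem coeff_evenCoord_mul_partialEven (t : Fin n) (a : FormalFun k l n) (e : Fin n →₀ ℕ) :
    coeff e (evenCoord t * partialEven t a) = (e t : k) • coeff e a := by
  rw [coeff_evenCoord_mul]
  split_ifs with h
  · rw [h, Nat.cast_zero, zero_smul]
  · rw [coeff_partialEven, sub_single_add_single h, Finsupp.tsub_apply, Finsupp.single_eq_same,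
      Nat.cast_pred (Nat.pos_of_ne_zero h), sub_add_cancel]

theorem partialEven_mul (t : Fin n) (a b : FormalFun k l n) :
    partialEven t (a * b) = partialEven t a * b + a * partialEven t b := by
  classical
  -- `y_t ∂/∂y_t` scales the coefficient of `y^e` by `e_t`, which is additive in `e`.
  have euler_mul : (evenCoord t : FormalFun k l n) * partialEven t (a * b) =
      evenCoord t * partialEven t a * b + a * (evenCoord t * partialEven t b) := by
    ext e
    rw [coeff_evenCoord_mul_partialEven, map_add, MvPowerSeries.coeff_mul, MvPowerSeries.coeff_mul,
      MvPowerSeries.coeff_mul, Finset.smul_sum, ← Finset.sum_add_distrib]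
    refine Finset.sum_congr rfl fun x hx => ?_
    rw [coeff_evenCoord_mul_partialEven, coeff_evenCoord_mul_partialEven,
      ← Finset.HasAntidiagonal.mem_antidiagonal.mp hx, smul_mul_assoc, mul_smul_comm, ← add_smul,
      Finsupp.add_apply, Nat.cast_add]
  have euler_mul' : (evenCoord t : FormalFun k l n) * partialEven t (a * b) =
      evenCoord t * (partialEven t a * b + a * partialEven t b) := by
    have hcomm : (evenCoord t : FormalFun k l n) * a = a * evenCoord t := MvPowerSeries.X_mul
    rw [euler_mul, mul_add, mul_assoc, ← mul_assoc a, ← hcomm, mul_assoc]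
  ext e
  rw [← coeff_evenCoord_mul_add_single t, euler_mul', coeff_evenCoord_mul_add_single]

theorem partialOdd_mul (t : Fin l) {i : ZMod 2} {a : FormalFun k l n}
    (ha : a ∈ parityPart k l n i) (b : FormalFun k l n) :
    partialOdd t (a * b) = partialOdd t a * b + sgn k i • (a * partialOdd t b) := by
  classical
  ext e
  rw [coeff_partialOdd, map_add, coeff_base_smul, MvPowerSeries.coeff_mul, MvPowerSeries.coeff_mul,
    MvPowerSeries.coeff_mul, Finset.smul_sum, ← Finset.sum_add_distrib, map_sum]
  exact Finset.sum_congr rfl fun x _ => contractLeft_mul _ (ha _) _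

theorem partialOdd_C (t : Fin l) (u : Ext k l) :
    partialOdd t (MvPowerSeries.C u : FormalFun k l n) = MvPowerSeries.C
      (CliffordAlgebra.contractLeft (Q := (0 : QuadraticForm k (Fin l → k)))
        (LinearMap.proj t : Module.Dual k (Fin l → k)) u) := by
  classical
  ext e
  rw [coeff_partialOdd, MvPowerSeries.coeff_C, MvPowerSeries.coeff_C]
  split_ifs
  exacts [rfl, map_zero _]

theorem partialEven_C (t : Fin n) (u : Ext k l) :
    partialEven t (MvPowerSeries.C u : FormalFun k l n) = 0 := by
  classical
  ext e
  rw [coeff_partialEven, MvPowerSeries.coeff_C, if_neg fun h => ?_, smul_zero, map_zero]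
  simpa using DFunLike.congr_fun h t

theorem partialEven_evenCoord (t s : Fin n) :
    partialEven t (evenCoord s : FormalFun k l n) = if t = s then 1 else 0 := by
  classical
  ext e
  rw [coeff_partialEven, evenCoord, MvPowerSeries.coeff_X]
  split_ifs with h hts hts
  · obtain rfl : e = 0 := by simpa [hts] using h
    simp
  · have : e t + 1 = 0 := by
      simpa [Finsupp.single_eq_of_ne hts] using DFunLike.congr_fun h t
    omega
  · subst hts
    rw [MvPowerSeries.coeff_one, if_neg fun he => h (by rw [he, zero_add]), smul_zero]
  · rw [smul_zero, map_zero]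

theorem partialEven_oddCoord (t : Fin n) (s : Fin l) :
    partialEven t (oddCoord s : FormalFun k l n) = 0 :=
  partialEven_C t _

theorem partialOdd_evenCoord (t : Fin l) (s : Fin n) :
    partialOdd t (evenCoord s : FormalFun k l n) = 0 := by
  classical
  ext e
  rw [coeff_partialOdd, evenCoord, MvPowerSeries.coeff_X]
  split_ifs
  exacts [CliffordAlgebra.contractLeft_one (Q := (0 : QuadraticForm k (Fin l → k))) _, map_zero _]

theorem partialOdd_oddCoord (t s : Fin l) :
    partialOdd t (oddCoord s : FormalFun k l n) = if t = s then 1 else 0 := by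
  rw [oddCoord, partialOdd_C, ExteriorAlgebra.ι, CliffordAlgebra.contractLeft_ι,
    LinearMap.proj_apply, Pi.single_apply]
  split_ifs
  · rw [map_one, map_one]
  · rw [map_zero, map_zero]

/-- The partial derivatives along the `y_j` and the `x_i` as one family. -/
def partialCoord (k : Type*) [Field k] : CoordIdx l n → Module.End k (FormalFun k l n) :=
  Sum.elim partialEven partialOdd

theorem partialCoord_coord (z w : CoordIdx l n) :
    partialCoord k z (coord k w) = if z = w then 1 else 0 := by
  rcases z with t | t <;> rcases w with s | s
  · exact (partialEven_evenCoord t s).trans (by simp)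
  · exact (partialEven_oddCoord t s).trans (by simp)
  · exact (partialOdd_evenCoord t s).trans (by simp)
  · exact (partialOdd_oddCoord t s).trans (by simp)

theorem isVectorField_partialEven (t : Fin n) :
    IsVectorField 0 0 (partialEven t : Module.End k (FormalFun k l n)) where
  map_parity i a ha e := by rw [zero_add]; exact Submodule.smul_mem _ _ (ha _)
  leibniz i a _ b := by rw [partialEven_mul, zero_mul, sgn_zero, one_smul]
  map_evenCoord _ := mem_lengthGE_zero _
  map_oddCoord _ := mem_lengthGE_zero _

theorem isVectorField_partialOdd (t : Fin l) :
    IsVectorField 1 0 (partialOdd t : Module.End k (FormalFun k l n)) where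
  map_parity i a ha e := contractLeft_mem_evenOdd _ (ha e)
  leibniz i a ha b := by rw [partialOdd_mul t ha, one_mul]
  map_evenCoord _ := mem_lengthGE_zero _
  map_oddCoord _ := mem_lengthGE_zero _

theorem isVectorField_partialCoord (z : CoordIdx l n) :
    IsVectorField (coordParity z) 0 (partialCoord k z) :=
  z.rec isVectorField_partialEven isVectorField_partialOdd

end PartialDerivatives

section VectorFields

variable {k : Type*} [Field k] {l n : ℕ} {i j : ZMod 2} {p q r : ℕ}
  {ξ η : Module.End k (FormalFun k l n)} {a : FormalFun k l n}

theorem IsVectorField.map_coord (h : IsVectorField i p ξ) (z : CoordIdx l n) :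
    ξ (coord k z) ∈ lengthGE k l n p :=
  z.rec h.map_evenCoord h.map_oddCoord

theorem IsVectorField.map_coord_parity (h : IsVectorField i p ξ) (z : CoordIdx l n) :
    ξ (coord k z) ∈ parityPart k l n (i + coordParity z) :=
  h.map_parity _ _ (coord_mem_parityPart z)

theorem IsVectorField.of_coord (h : IsVectorField i q ξ)
    (hc : ∀ z, ξ (coord k z) ∈ lengthGE k l n p) : IsVectorField i p ξ :=
  ⟨h.map_parity, h.leibniz, fun t => hc (Sum.inl t), fun t => hc (Sum.inr t)⟩

theorem IsVectorField.mono (h : IsVectorField i q ξ) (hpq : p ≤ q) : IsVectorField i p ξ :=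
  h.of_coord fun z => lengthGE_anti hpq (h.map_coord z)

theorem IsVectorField.map_one (h : IsVectorField i p ξ) : ξ 1 = 0 := by
  have h11 := h.leibniz 0 1 one_mem_parityPart 1
  rwa [mul_zero, sgn_zero, one_smul, mul_one, mul_one, one_mul, left_eq_add] at h11

theorem isVectorField_zero : IsVectorField i p (0 : Module.End k (FormalFun k l n)) :=
  ⟨fun _ _ _ => zero_mem _, fun _ _ _ _ => by simp, fun _ => zero_mem _, fun _ => zero_mem _⟩

theorem IsVectorField.add (h : IsVectorField i p ξ) (h' : IsVectorField i p η) :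
    IsVectorField i p (ξ + η) where
  map_parity t a ha := add_mem (h.map_parity t a ha) (h'.map_parity t a ha)
  leibniz t a ha b := by
    simp only [LinearMap.add_apply]
    rw [h.leibniz t a ha b, h'.leibniz t a ha b, add_mul, mul_add, smul_add]
    abel
  map_evenCoord t := add_mem (h.map_evenCoord t) (h'.map_evenCoord t)
  map_oddCoord t := add_mem (h.map_oddCoord t) (h'.map_oddCoord t)

theorem IsVectorField.smul (h : IsVectorField i p ξ) (c : k) : IsVectorField i p (c • ξ) where
  map_parity t a ha := Submodule.smul_mem _ _ (h.map_parity t a ha)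
  leibniz t a ha b := by
    simp only [LinearMap.smul_apply]
    rw [h.leibniz t a ha b, smul_add, smul_mul_assoc, mul_smul_comm, smul_comm c]
  map_evenCoord t := Submodule.smul_mem _ _ (h.map_evenCoord t)
  map_oddCoord t := Submodule.smul_mem _ _ (h.map_oddCoord t)

theorem IsVectorField.sub (h : IsVectorField i p ξ) (h' : IsVectorField i p η) :
    IsVectorField i p (ξ - η) := by
  rw [sub_eq_add_neg, ← neg_one_smul k η]
  exact h.add (h'.smul _)

theorem IsVectorField.sum {ι : Type*} (s : Finset ι) {ξ : ι → Module.End k (FormalFun k l n)}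
    (h : ∀ t ∈ s, IsVectorField i p (ξ t)) : IsVectorField i p (∑ t ∈ s, ξ t) :=
  Finset.sum_induction ξ (IsVectorField i p) (fun _ _ => IsVectorField.add) isVectorField_zero h

theorem IsVectorField.map_lengthGE (h : IsVectorField i p ξ) (hr : r ≤ q + p - 1)
    (ha : a ∈ lengthGE k l n q) : ξ a ∈ lengthGE k l n r := by
  induction r generalizing q a with
  | zero => exact mem_lengthGE_zero _
  | succ r ih =>
    have map_succ : ∀ q, r + 1 ≤ q + p →
        lengthGE k l n (q + 1) ≤ (lengthGE k l n (r + 1)).comap ξ := fun q hq => by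
      refine lengthGE_succ_le.trans (iSup_le fun z => Submodule.map_le_iff_le_comap.mpr ?_)
      intro b hb
      rw [Submodule.mem_comap, Submodule.mem_comap, LinearMap.mulLeft_apply,
        h.leibniz _ _ (coord_mem_parityPart z)]
      exact add_mem (lengthGE_anti (by omega) (mul_mem_lengthGE (h.map_coord z) hb))
        (Submodule.smul_mem _ _ (lengthGE_anti (by omega)
          (mul_mem_lengthGE (coord_mem_lengthGE z) (ih (by omega) hb))))
    rcases q with _ | q
    · obtain ⟨c, hc⟩ := exists_sub_smul_one_mem_lengthGE a
      have hξ := map_succ 0 (by omega) hc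
      rwa [Submodule.mem_comap, map_sub, map_smul, h.map_one, smul_zero, sub_zero] at hξ
    · exact map_succ q (by omega) ha

theorem IsVectorField.eq_zero (h : IsVectorField i p ξ) (h0 : ∀ z, ξ (coord k z) = 0) : ξ = 0 :=
  LinearMap.ext fun a => eq_zero_of_forall_mem_lengthGE fun r =>
    (h.of_coord (p := r + 1) fun z => h0 z ▸ zero_mem _).map_lengthGE (q := 0) (by omega)
      (mem_lengthGE_zero a)

theorem IsVectorField.ext (h : IsVectorField i p ξ) (h' : IsVectorField i q η)
    (he : ∀ z, ξ (coord k z) = η (coord k z)) : ξ = η :=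
  sub_eq_zero.mp (((h.mono (Nat.zero_le _)).sub (h'.mono (Nat.zero_le _))).eq_zero fun z =>
    sub_eq_zero.mpr (he z))

theorem superBracket_apply (a : FormalFun k l n) :
    superBracket i j ξ η a = ξ (η a) - sgn k (i * j) • η (ξ a) := rfl

theorem superBracket_zero_one : superBracket 0 1 ξ η = ξ * η - η * ξ := by
  rw [superBracket, zero_mul, sgn_zero, one_smul]

theorem superBracket_one_one : superBracket 1 1 ξ η = ξ * η + η * ξ := by
  rw [superBracket, mul_one, sgn_one, neg_one_smul k (η * ξ), sub_neg_eq_add]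

theorem IsVectorField.superBracket (h : IsVectorField i p ξ) (h' : IsVectorField j q η)
    (hr : r ≤ p + q - 1) : IsVectorField (i + j) r (superBracket i j ξ η) := by
  refine IsVectorField.of_coord (q := 0) ⟨fun t a ha => ?_, fun t a ha b => ?_,
    fun _ => mem_lengthGE_zero _, fun _ => mem_lengthGE_zero _⟩ fun z => ?_
  · refine sub_mem ?_ (Submodule.smul_mem _ _ ?_)
    · rw [add_assoc]
      exact h.map_parity _ _ (h'.map_parity _ _ ha)
    · rw [add_assoc, add_left_comm]
      exact h'.map_parity _ _ (h.map_parity _ _ ha)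
  · simp only [superBracket_apply]
    rw [h'.leibniz t a ha, h.leibniz t a ha, map_add, map_add, map_smul, map_smul,
      h.leibniz _ _ (h'.map_parity _ _ ha), h.leibniz t a ha, h'.leibniz _ _ (h.map_parity _ _ ha),
      h'.leibniz t a ha]
    simp only [mul_add, add_mul, sgn_add, sub_mul, mul_sub, smul_mul_assoc, mul_smul_comm]
    rw [mul_comm j i]
    have hsq := sgn_mul_self (k := k) (i * j)
    match_scalars <;> first | ring1 | linear_combination (-sgn k (j * t)) * hsq
  · exact sub_mem (h.map_lengthGE (by omega) (h'.map_coord z))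
      (Submodule.smul_mem _ _ (h'.map_lengthGE (by omega) (h.map_coord z)))

theorem IsVectorField.mul_self (h : IsVectorField 1 p ξ) (hr : r ≤ p + p - 1) :
    IsVectorField 0 r (ξ * ξ) := by
  refine IsVectorField.of_coord (q := 0) ⟨fun t a ha => ?_, fun t a ha b => ?_,
    fun _ => mem_lengthGE_zero _, fun _ => mem_lengthGE_zero _⟩ fun z =>
      h.map_lengthGE (by omega) (h.map_coord z)
  · have hξξ := h.map_parity _ _ (h.map_parity _ _ ha)
    rwa [← add_assoc, CharTwo.add_self_eq_zero] at hξξ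
  · simp only [Module.End.mul_apply]
    rw [h.leibniz t a ha, map_add, map_smul, h.leibniz _ _ (h.map_parity _ _ ha), h.leibniz t a ha,
      zero_mul, sgn_zero, one_smul, one_mul, one_mul, sgn_add, sgn_one, neg_one_mul, neg_smul,
      smul_add, smul_smul, sgn_mul_self, one_smul]
    abel

theorem isVectorField_mulLeft_partialCoord {z : CoordIdx l n}
    (ha : a ∈ parityPart k l n (i + coordParity z)) (hp : a ∈ lengthGE k l n p) :
    IsVectorField i p (LinearMap.mulLeft k a * partialCoord k z) := by
  have hz := isVectorField_partialCoord (k := k) z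
  refine IsVectorField.of_coord (q := 0) ⟨fun t b hb => ?_, fun t b hb c => ?_,
    fun _ => mem_lengthGE_zero _, fun _ => mem_lengthGE_zero _⟩ fun w => ?_
  · have parity_eq : ∀ i s t : ZMod 2, i + s + (s + t) = i + t := by decide
    rw [← parity_eq i (coordParity z)]
    exact mul_mem_parityPart ha (hz.map_parity _ _ hb)
  · have parity_eq : ∀ i s t : ZMod 2, s * t + (i + s) * t = i * t := by decide
    simp only [Module.End.mul_apply, LinearMap.mulLeft_apply]
    rw [hz.leibniz t b hb, mul_add, mul_smul_comm, ← mul_assoc a b, mul_eq_sgn_smul ha hb,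
      ← mul_assoc, smul_mul_assoc, smul_smul, ← sgn_add, mul_assoc, mul_assoc, parity_eq]
  · rw [Module.End.mul_apply, LinearMap.mulLeft_apply, partialCoord_coord]
    split_ifs
    · rwa [mul_one]
    · rw [mul_zero]
      exact zero_mem _

theorem IsVectorField.apply_eq_sum (h : IsVectorField i p ξ) (a : FormalFun k l n) :
    ξ a = ∑ z, ξ (coord k z) * partialCoord k z a := by
  have hsum : ξ = ∑ z, LinearMap.mulLeft k (ξ (coord k z)) * partialCoord k z := by
    refine h.ext (IsVectorField.sum _ fun z _ =>
      isVectorField_mulLeft_partialCoord (h.map_coord_parity z) (h.map_coord z)) fun w => ?_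
    simp only [LinearMap.sum_apply, Module.End.mul_apply, LinearMap.mulLeft_apply,
      partialCoord_coord, mul_ite, mul_one, mul_zero, Finset.sum_ite_eq', Finset.mem_univ, if_true]
  conv_lhs => rw [hsum]
  simp only [LinearMap.sum_apply, Module.End.mul_apply, LinearMap.mulLeft_apply]

theorem IsVectorField.partialCoord_apply (h : IsVectorField i p ξ) (z : CoordIdx l n)
    (a : FormalFun k l n) :
    partialCoord k z (ξ a) = sgn k (coordParity z * i) • ξ (partialCoord k z a) +
      ∑ w, partialCoord k z (ξ (coord k w)) * partialCoord k w a := by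
  have hbracket := ((isVectorField_partialCoord (k := k) z).superBracket h
    (r := 0) (Nat.zero_le _)).apply_eq_sum a
  rw [superBracket_apply, sub_eq_iff_eq_add'] at hbracket
  rw [hbracket]
  congr 1
  refine Finset.sum_congr rfl fun w _ => ?_
  rw [superBracket_apply, partialCoord_coord]
  split_ifs
  · rw [h.map_one, smul_zero, sub_zero]
  · rw [map_zero, smul_zero, sub_zero]

end VectorFields

section Divergence

variable {k : Type*} [Field k] {l n : ℕ} {i j : ZMod 2} {p q : ℕ}
  {ξ η : Module.End k (FormalFun k l n)}

theorem divergence_eq_sum (i : ZMod 2) (ξ : Module.End k (FormalFun k l n)) :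
    divergence i ξ = ∑ z : CoordIdx l n, sgn k ((i + coordParity z) * coordParity z) •
      partialCoord k z (ξ (coord k z)) := by
  simp [Fintype.sum_sum_type, divergence, coordParity, partialCoord, coord, sgn_zero,
    Finset.smul_sum]

theorem isLinearMap_divergence (i : ZMod 2) :
    IsLinearMap k (divergence i : Module.End k (FormalFun k l n) → FormalFun k l n) where
  map_add ξ η := by
    simp only [divergence_eq_sum, LinearMap.add_apply, map_add, smul_add, Finset.sum_add_distrib]
  map_smul c ξ := by
    simp only [divergence_eq_sum, LinearMap.smul_apply, map_smul, Finset.smul_sum, smul_comm c]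

theorem divergence_zero (i : ZMod 2) : divergence i (0 : Module.End k (FormalFun k l n)) = 0 :=
  (isLinearMap_divergence i).map_zero

theorem divergence_add (i : ZMod 2) (ξ η : Module.End k (FormalFun k l n)) :
    divergence i (ξ + η) = divergence i ξ + divergence i η :=
  (isLinearMap_divergence i).map_add ξ η

theorem divergence_smul (i : ZMod 2) (c : k) (ξ : Module.End k (FormalFun k l n)) :
    divergence i (c • ξ) = c • divergence i ξ :=
  (isLinearMap_divergence i).map_smul c ξ

theorem divergence_sub (i : ZMod 2) (ξ η : Module.End k (FormalFun k l n)) :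
    divergence i (ξ - η) = divergence i ξ - divergence i η :=
  (isLinearMap_divergence i).map_sub ξ η

theorem divergence_sum {ι : Type*} (i : ZMod 2) (s : Finset ι)
    (ξ : ι → Module.End k (FormalFun k l n)) :
    divergence i (∑ r ∈ s, ξ r) = ∑ r ∈ s, divergence i (ξ r) :=
  map_sum ((isLinearMap_divergence i).mk' _) ξ s

theorem IsVectorField.divergence_mem_lengthGE (h : IsVectorField i (p + 1) ξ) :
    divergence i ξ ∈ lengthGE k l n p := by
  rw [divergence_eq_sum]
  exact sum_mem fun z _ => Submodule.smul_mem _ _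
    ((isVectorField_partialCoord z).map_lengthGE (by omega) (h.map_coord z))

theorem IsVectorField.divergence_mem_parityPart (h : IsVectorField i p ξ) :
    divergence i ξ ∈ parityPart k l n i := by
  have parity_eq : ∀ i s : ZMod 2, s + (i + s) = i := by decide
  rw [divergence_eq_sum]
  refine sum_mem fun z _ => Submodule.smul_mem _ _ ?_
  rw [← parity_eq i (coordParity z)]
  exact (isVectorField_partialCoord (k := k) z).map_parity _ _ (h.map_coord_parity z)

theorem divergence_mulLeft_partialCoord (i : ZMod 2) (z : CoordIdx l n) (a : FormalFun k l n) :
    divergence i (LinearMap.mulLeft k a * partialCoord k z) =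
      sgn k ((i + coordParity z) * coordParity z) • partialCoord k z a := by
  rw [divergence_eq_sum, Finset.sum_eq_single z]
  · rw [Module.End.mul_apply, LinearMap.mulLeft_apply, partialCoord_coord, if_pos rfl, mul_one]
  · intro w _ hw
    rw [Module.End.mul_apply, LinearMap.mulLeft_apply, partialCoord_coord, if_neg hw.symm, mul_zero,
      map_zero, smul_zero]
  · exact fun h => absurd (Finset.mem_univ z) h

/-- The supertrace of the product of the Jacobian matrices of `ξ` and `η`, where `i` is the parity
of `ξη`. It is the failure of `∇(ξη) = ξ(∇η)`. -/
def jacobianTrace (i : ZMod 2) (ξ η : Module.End k (FormalFun k l n)) : FormalFun k l n :=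
  ∑ z : CoordIdx l n, ∑ w : CoordIdx l n, sgn k ((i + coordParity z) * coordParity z) •
    (partialCoord k z (ξ (coord k w)) * partialCoord k w (η (coord k z)))

theorem jacobianTrace_comm (h : IsVectorField i p ξ) (h' : IsVectorField j q η) :
    jacobianTrace (i + j) ξ η = sgn k (i * j) • jacobianTrace (i + j) η ξ := by
  have parity_eq : ∀ i j s t : ZMod 2, (i + j + t) * t + (t + (i + s)) * (s + (j + t)) =
    i * j + (i + j + s) * s := by decide
  rw [jacobianTrace, jacobianTrace, Finset.sum_comm, Finset.smul_sum]
  refine Finset.sum_congr rfl fun z _ => ?_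
  rw [Finset.smul_sum]
  refine Finset.sum_congr rfl fun w _ => ?_
  rw [mul_eq_sgn_smul
      ((isVectorField_partialCoord (k := k) w).map_parity _ _ (h.map_coord_parity z))
      ((isVectorField_partialCoord (k := k) z).map_parity _ _ (h'.map_coord_parity w)),
    smul_smul, smul_smul, ← sgn_add, ← sgn_add, parity_eq]

theorem IsVectorField.divergence_mul (h : IsVectorField i p ξ) (j : ZMod 2)
    (η : Module.End k (FormalFun k l n)) :
    divergence (i + j) (ξ * η) = ξ (divergence j η) + jacobianTrace (i + j) ξ η := by
  have parity_eq : ∀ i j s : ZMod 2, (i + j + s) * s + s * i = (j + s) * s := by decide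
  rw [divergence_eq_sum, divergence_eq_sum, jacobianTrace, map_sum, ← Finset.sum_add_distrib]
  refine Finset.sum_congr rfl fun z _ => ?_
  rw [Module.End.mul_apply, h.partialCoord_apply, smul_add, smul_smul, ← sgn_add, parity_eq,
    map_smul, Finset.smul_sum]

theorem divergence_superBracket (h : IsVectorField i p ξ) (h' : IsVectorField j q η) :
    divergence (i + j) (superBracket i j ξ η) =
      ξ (divergence j η) - sgn k (i * j) • η (divergence i ξ) := by
  have hηξ := h'.divergence_mul i ξ
  rw [add_comm j i] at hηξ
  rw [superBracket, divergence_sub, divergence_smul, h.divergence_mul, hηξ, jacobianTrace_comm h h',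
    smul_add, add_sub_add_right_eq_sub]

end Divergence

section Series

variable {k : Type*} [Field k] {l n : ℕ} {i : ZMod 2}
  {a : ℕ → FormalFun k l n} {ξ : Module.End k (FormalFun k l n)}
  {Q : ℕ → Module.End k (FormalFun k l n)}

/-- The sum of a series of functions `a r ∈ Ŝ_{≥ r}`. Only the terms with `r ≤ |e| + l` contribute
to the coefficient of `y^e`, so the sum is finite in each degree. -/
def seriesSum (a : ℕ → FormalFun k l n) : FormalFun k l n := fun e =>
  ∑ r ∈ Finset.range (e.degree + l + 1), MvPowerSeries.coeff e (a r)

theorem coeff_seriesSum (ha : ∀ r, a r ∈ lengthGE k l n r) (e : Fin n →₀ ℕ) (N : ℕ) :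
    MvPowerSeries.coeff e (seriesSum a) =
      ∑ r ∈ Finset.range (N + (e.degree + l + 1)), MvPowerSeries.coeff e (a r) := by
  rw [add_comm N, Finset.sum_range_add, Finset.sum_eq_zero (s := Finset.range N), add_zero]
  · rfl
  · exact fun r _ => coeff_eq_zero_of_mem_lengthGE (ha _) (by omega)

theorem seriesSum_sub_sum_mem_lengthGE (ha : ∀ r, a r ∈ lengthGE k l n r) (N : ℕ) :
    seriesSum a - ∑ r ∈ Finset.range N, a r ∈ lengthGE k l n N := by
  refine mem_lengthGE_iff.mpr fun e => ?_
  rw [map_sub, coeff_seriesSum ha e N, Finset.sum_range_add, map_sum, add_sub_cancel_left]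
  exact sum_mem fun r _ => exteriorGE_anti (by omega) (mem_lengthGE_iff.mp (ha (N + r)) e)

theorem mem_parityPart_of_approx {b : FormalFun k l n}
    (h : ∀ N, ∃ c ∈ parityPart k l n i, b - c ∈ lengthGE k l n N) : b ∈ parityPart k l n i :=
  fun e => by
    obtain ⟨c, hc, hbc⟩ := h (e.degree + l + 1)
    have hcoeff := coeff_eq_zero_of_mem_lengthGE hbc (Nat.lt_succ_self _)
    rw [map_sub, sub_eq_zero] at hcoeff
    exact hcoeff ▸ hc e

theorem seriesSum_mem_parityPart (ha : ∀ r, a r ∈ lengthGE k l n r)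
    (hp : ∀ r, a r ∈ parityPart k l n i) : seriesSum a ∈ parityPart k l n i :=
  mem_parityPart_of_approx fun N =>
    ⟨_, sum_mem fun r _ => hp r, seriesSum_sub_sum_mem_lengthGE ha N⟩

/-- The pointwise sum of a series of operators `Q r` with `Q r a ∈ Ŝ_{≥ r}` for all `a`. -/
def operatorSum (Q : ℕ → Module.End k (FormalFun k l n)) : Module.End k (FormalFun k l n) where
  toFun a := seriesSum fun r => Q r a
  map_add' a b := by
    ext e
    change ∑ r ∈ Finset.range (e.degree + l + 1), MvPowerSeries.coeff e (Q r (a + b)) =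
      ∑ r ∈ Finset.range (e.degree + l + 1), MvPowerSeries.coeff e (Q r a) +
        ∑ r ∈ Finset.range (e.degree + l + 1), MvPowerSeries.coeff e (Q r b)
    simp only [map_add, Finset.sum_add_distrib]
  map_smul' c a := by
    ext e
    change ∑ r ∈ Finset.range (e.degree + l + 1), MvPowerSeries.coeff e (Q r (c • a)) =
      c • ∑ r ∈ Finset.range (e.degree + l + 1), MvPowerSeries.coeff e (Q r a)
    simp only [map_smul, Finset.smul_sum, coeff_base_smul]

theorem IsVectorField.apply_mem_lengthGE {r : ℕ} (h : IsVectorField i (r + 1) ξ)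
    (a : FormalFun k l n) : ξ a ∈ lengthGE k l n r :=
  h.map_lengthGE (q := 0) (by omega) (mem_lengthGE_zero a)

theorem operatorSum_sub_sum_apply_mem_lengthGE (hQ : ∀ r, IsVectorField i (r + 1) (Q r)) (N : ℕ)
    (a : FormalFun k l n) : (operatorSum Q - ∑ r ∈ Finset.range N, Q r) a ∈ lengthGE k l n N := by
  rw [LinearMap.sub_apply, LinearMap.sum_apply]
  exact seriesSum_sub_sum_mem_lengthGE (fun r => (hQ r).apply_mem_lengthGE a) N

theorem isVectorField_of_approx (h : ∀ N, ∃ η : Module.End k (FormalFun k l n),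
    IsVectorField i 0 η ∧ ∀ a, (ξ - η) a ∈ lengthGE k l n N) : IsVectorField i 0 ξ := by
  refine ⟨fun j a ha => mem_parityPart_of_approx fun N => ?_, fun j a ha b => ?_,
    fun _ => mem_lengthGE_zero _, fun _ => mem_lengthGE_zero _⟩
  · obtain ⟨η, hη, hξ⟩ := h N
    exact ⟨η a, hη.map_parity j a ha, hξ a⟩
  · refine sub_eq_zero.mp (eq_zero_of_forall_mem_lengthGE fun N => ?_)
    obtain ⟨η, hη, hξ⟩ := h N
    have hsub : ξ (a * b) - (ξ a * b + sgn k (i * j) • (a * ξ b)) = (ξ - η) (a * b) -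
        ((ξ - η) a * b + sgn k (i * j) • (a * (ξ - η) b)) := by
      simp only [LinearMap.sub_apply]
      rw [hη.leibniz j a ha b, sub_mul, mul_sub, smul_sub]
      abel
    rw [hsub]
    exact sub_mem (hξ _) (add_mem (mul_mem_lengthGE (q := 0) (hξ a) (mem_lengthGE_zero b))
      (Submodule.smul_mem _ _
        (lengthGE_anti (Nat.le_add_left N 0) (mul_mem_lengthGE (mem_lengthGE_zero a) (hξ b)))))

theorem isVectorField_operatorSum_sub_sum (hQ : ∀ r, IsVectorField i (r + 1) (Q r)) (N : ℕ) :
    IsVectorField i (N + 1) (operatorSum Q - ∑ r ∈ Finset.range N, Q r) := by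
  have hsum : ∀ N, IsVectorField i 0 (∑ r ∈ Finset.range N, Q r) := fun N =>
    IsVectorField.sum _ fun r _ => (hQ r).mono (Nat.zero_le _)
  have hsub := (isVectorField_of_approx fun N =>
    ⟨_, hsum N, operatorSum_sub_sum_apply_mem_lengthGE hQ N⟩).sub (hsum N)
  refine hsub.of_coord fun z => ?_
  have hz := add_mem (operatorSum_sub_sum_apply_mem_lengthGE hQ (N + 1) (coord k z))
    ((hQ N).map_coord z)
  rwa [Finset.sum_range_succ, ← sub_sub, LinearMap.sub_apply, sub_add_cancel] at hz

end Series

section CauchyProduct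

open Finset.HasAntidiagonal (antidiagonal mem_antidiagonal)

theorem sum_sum_sub_sum_antidiagonal_mem {S M : Type*} [AddCommGroup M] [SetLike S M]
    [AddSubgroupClass S M] (s : S) (N : ℕ) (F : ℕ → ℕ → M) (hF : ∀ i j, N ≤ i + j → F i j ∈ s) :
    ∑ i ∈ Finset.range N, ∑ j ∈ Finset.range N, F i j -
      ∑ r ∈ Finset.range N, ∑ x ∈ antidiagonal r, F x.1 x.2 ∈ s := by
  have hdiag : ∑ r ∈ Finset.range N, ∑ x ∈ antidiagonal r, F x.1 x.2 =
      ∑ i ∈ Finset.range N, ∑ j ∈ Finset.range (N - i), F i j := by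
    rw [← Finset.sum_range_diag_flip]
    exact Finset.sum_congr rfl fun r _ => Finset.Nat.sum_antidiagonal_eq_sum_range_succ F r
  rw [hdiag, ← Finset.sum_sub_distrib]
  refine sum_mem fun i hi => ?_
  have hsplit := Finset.sum_range_add (F i) (N - i) i
  rw [Nat.sub_add_cancel (Finset.mem_range.mp hi).le] at hsplit
  rw [hsplit, add_sub_cancel_left]
  exact sum_mem fun j _ => hF _ _ (by omega)

variable {k : Type*} [Field k]

theorem succ_smul_sum_antidiagonal_succ {M : Type*} [AddCommGroup M] [Module k M]
    (F : ℕ → ℕ → M) (r : ℕ) :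
    ((r + 1 : ℕ) : k) • ∑ x ∈ antidiagonal (r + 1), F x.1 x.2 =
      ∑ x ∈ antidiagonal r, (((x.1 + 1 : ℕ) : k) • F (x.1 + 1) x.2 +
        ((x.2 + 1 : ℕ) : k) • F x.1 (x.2 + 1)) := by
  have hfst := Finset.Nat.sum_antidiagonal_succ (n := r) (f := fun x => (x.1 : k) • F x.1 x.2)
  have hsnd := Finset.Nat.sum_antidiagonal_succ' (n := r) (f := fun x => (x.2 : k) • F x.1 x.2)
  simp only [Nat.cast_zero, zero_smul, zero_add] at hfst hsnd
  rw [Finset.sum_add_distrib, ← hfst, ← hsnd, ← Finset.sum_add_distrib, Finset.smul_sum]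
  refine Finset.sum_congr rfl fun x hx => ?_
  rw [← add_smul, ← Nat.cast_add, mem_antidiagonal.mp hx]

-- With generating functions, `hF` says that `∑ F i j t^(i + j)` solves `u' = δ u`.
theorem sum_antidiagonal_eq_zero_of_leibniz [CharZero k] {M : Type*} [AddCommGroup M] [Module k M]
    {F : ℕ → ℕ → M} (δ : Module.End k M) (h0 : F 0 0 = 0)
    (hF : ∀ i j, ((i + 1 : ℕ) : k) • F (i + 1) j + ((j + 1 : ℕ) : k) • F i (j + 1) = δ (F i j))
    (r : ℕ) : ∑ x ∈ antidiagonal r, F x.1 x.2 = 0 := by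
  induction r with
  | zero => rw [Finset.Nat.antidiagonal_zero, Finset.sum_singleton, h0]
  | succ r ih =>
    refine (smul_eq_zero_iff_right (Nat.cast_ne_zero (R := k).mpr (Nat.succ_ne_zero r))).mp ?_
    rw [succ_smul_sum_antidiagonal_succ]
    simp only [hF]
    rw [← map_sum, ih, map_zero]

variable {l n : ℕ} {i : ZMod 2}

theorem operatorSum_seriesSum_sub_sum_mem_lengthGE {Q : ℕ → Module.End k (FormalFun k l n)}
    {g : ℕ → FormalFun k l n} (hQ : ∀ r, IsVectorField i (r + 1) (Q r))
    (hg : ∀ r, g r ∈ lengthGE k l n r) (N : ℕ) :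
    operatorSum Q (seriesSum g) -
      ∑ r ∈ Finset.range N, ∑ x ∈ antidiagonal r, Q x.1 (g x.2) ∈ lengthGE k l n N := by
  have hQsum : IsVectorField i 1 (∑ r ∈ Finset.range N, Q r) :=
    IsVectorField.sum _ fun r _ => (hQ r).mono (by omega)
  have hoperator := operatorSum_sub_sum_apply_mem_lengthGE hQ N (seriesSum g)
  have hseries := hQsum.map_lengthGE (r := N) (by omega) (seriesSum_sub_sum_mem_lengthGE hg N)
  have hsquare := sum_sum_sub_sum_antidiagonal_mem (lengthGE k l n N) N (fun i j => Q i (g j))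
    fun i j hij => (hQ i).map_lengthGE (by omega) (hg j)
  have hprod : (∑ r ∈ Finset.range N, Q r) (∑ r ∈ Finset.range N, g r) =
      ∑ i ∈ Finset.range N, ∑ j ∈ Finset.range N, Q i (g j) := by
    simp only [LinearMap.sum_apply, map_sum]
    exact Finset.sum_comm
  have hsum := add_mem (add_mem hoperator hseries) hsquare
  rwa [← hprod, LinearMap.sub_apply, map_sub, sub_add_sub_cancel, sub_add_sub_cancel] at hsum

end CauchyProduct

section GaugeSeries

variable {k : Type*} [Field k] {l n : ℕ} {ξ Q : Module.End k (FormalFun k l n)}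
  {f a : FormalFun k l n}

/-- The term of order `r` of the conjugate `e^ξ Q e^{-ξ}`. -/
def gaugeField (ξ Q : Module.End k (FormalFun k l n)) (r : ℕ) : Module.End k (FormalFun k l n) :=
  (r.factorial : k)⁻¹ • (superBracket 0 1 ξ)^[r] Q

/-- The term of order `r` of the function `f'` in the gauge transform
`e^{(ξ, 0)} · (m, Πf) = (m', Πf')`. -/
def gaugeFun (ξ : Module.End k (FormalFun k l n)) (f : FormalFun k l n) : ℕ → FormalFun k l n
  | 0 => f
  | r + 1 => ((r + 1).factorial : k)⁻¹ • (ξ ^ r) (ξ f + (2⁻¹ : k) • divergence 0 ξ)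

theorem IsVectorField.pow_apply_mem_lengthGE {q : ℕ} (hξ : IsVectorField 0 2 ξ)
    (ha : a ∈ lengthGE k l n q) (r : ℕ) : (ξ ^ r) a ∈ lengthGE k l n (q + r) := by
  induction r with
  | zero => exact ha
  | succ r ih =>
    rw [pow_succ', Module.End.mul_apply]
    exact hξ.map_lengthGE (by omega) ih

theorem IsVectorField.map_parityPart_of_even {i : ZMod 2} {p : ℕ} (hξ : IsVectorField 0 p ξ)
    (ha : a ∈ parityPart k l n i) : ξ a ∈ parityPart k l n i := by
  simpa only [zero_add] using hξ.map_parity i a ha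

theorem IsVectorField.pow_apply_mem_parityPart {i : ZMod 2} {p : ℕ} (hξ : IsVectorField 0 p ξ)
    (ha : a ∈ parityPart k l n i) (r : ℕ) : (ξ ^ r) a ∈ parityPart k l n i := by
  induction r with
  | zero => exact ha
  | succ r ih =>
    rw [pow_succ', Module.End.mul_apply]
    exact hξ.map_parityPart_of_even ih

theorem IsVectorField.apply_add_divergence_mem_lengthGE {p : ℕ} (hξ : IsVectorField 0 (p + 1) ξ)
    (hf : f ∈ lengthGE k l n 1) : ξ f + (2⁻¹ : k) • divergence 0 ξ ∈ lengthGE k l n p :=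
  add_mem (hξ.map_lengthGE (by omega) hf) (Submodule.smul_mem _ _ hξ.divergence_mem_lengthGE)

theorem gaugeFun_mem_lengthGE (hξ : IsVectorField 0 2 ξ) (hf : f ∈ lengthGE k l n 1) (r : ℕ) :
    gaugeFun ξ f r ∈ lengthGE k l n r := by
  rcases r with _ | r
  · exact mem_lengthGE_zero f
  · refine Submodule.smul_mem _ _ ?_
    rw [add_comm]
    exact hξ.pow_apply_mem_lengthGE (hξ.apply_add_divergence_mem_lengthGE hf) r

theorem gaugeFun_mem_parityPart {p : ℕ} (hξ : IsVectorField 0 p ξ) (hf : f ∈ parityPart k l n 0)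
    (r : ℕ) : gaugeFun ξ f r ∈ parityPart k l n 0 := by
  rcases r with _ | r
  · exact hf
  · exact Submodule.smul_mem _ _ (hξ.pow_apply_mem_parityPart (add_mem
      (hξ.map_parityPart_of_even hf) (Submodule.smul_mem _ _ hξ.divergence_mem_parityPart)) r)

theorem isVectorField_gaugeField (hξ : IsVectorField 0 2 ξ) (hQ : IsVectorField 1 1 Q) (r : ℕ) :
    IsVectorField 1 (r + 1) (gaugeField ξ Q r) := by
  refine IsVectorField.smul ?_ _
  induction r with
  | zero => exact hQ
  | succ r ih =>
    rw [Function.iterate_succ_apply']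
    exact hξ.superBracket ih (by omega)

theorem gaugeField_zero : gaugeField ξ Q 0 = Q := by
  rw [gaugeField, Nat.factorial_zero, Nat.cast_one, inv_one, one_smul, Function.iterate_zero, id]

section CharZero

variable [CharZero k]

theorem succ_smul_inv_factorial_smul {M : Type*} [AddCommGroup M] [Module k M] (r : ℕ) (x : M) :
    ((r + 1 : ℕ) : k) • ((r + 1).factorial : k)⁻¹ • x = (r.factorial : k)⁻¹ • x := by
  rw [smul_smul, Nat.factorial_succ, Nat.cast_mul, mul_inv,
    mul_inv_cancel_left₀ (Nat.cast_ne_zero.mpr (Nat.succ_ne_zero r))]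

theorem succ_smul_gaugeField (r : ℕ) : ((r + 1 : ℕ) : k) • gaugeField ξ Q (r + 1) =
    ξ * gaugeField ξ Q r - gaugeField ξ Q r * ξ := by
  rw [gaugeField, gaugeField, succ_smul_inv_factorial_smul r ((superBracket 0 1 ξ)^[r + 1] Q),
    Function.iterate_succ_apply', superBracket_zero_one, smul_sub, mul_smul_comm, smul_mul_assoc]

theorem succ_smul_gaugeFun (r : ℕ) : ((r + 1 : ℕ) : k) • gaugeFun ξ f (r + 1) =
    ξ (gaugeFun ξ f r) + if r = 0 then (2⁻¹ : k) • divergence 0 ξ else 0 := by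
  rw [gaugeFun, succ_smul_inv_factorial_smul]
  rcases r with _ | r
  · rw [Nat.factorial_zero, Nat.cast_one, inv_one, one_smul, pow_zero, Module.End.one_apply,
      if_pos rfl, gaugeFun]
  · rw [if_neg (Nat.succ_ne_zero r), add_zero, gaugeFun, pow_succ', Module.End.mul_apply, map_smul]

theorem sum_gaugeField_mul_eq_zero (hQ : Q * Q = 0) (r : ℕ) :
    ∑ x ∈ Finset.HasAntidiagonal.antidiagonal r, gaugeField ξ Q x.1 * gaugeField ξ Q x.2 = 0 := by
  refine sum_antidiagonal_eq_zero_of_leibniz (k := k)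
    (F := fun i j => gaugeField ξ Q i * gaugeField ξ Q j)
    (LinearMap.mulLeft k ξ - LinearMap.mulRight k ξ) ?_ (fun i j => ?_) r
  · rw [gaugeField_zero, hQ]
  · rw [← smul_mul_assoc, ← mul_smul_comm, succ_smul_gaugeField, succ_smul_gaugeField,
      LinearMap.sub_apply, LinearMap.mulLeft_apply, LinearMap.mulRight_apply,
      sub_mul, mul_sub, mul_assoc, mul_assoc, mul_assoc, sub_add_sub_cancel]

theorem succ_smul_divergence_gaugeField (hξ : IsVectorField 0 2 ξ) (hQ : IsVectorField 1 1 Q)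
    (r : ℕ) : ((r + 1 : ℕ) : k) • divergence 1 (gaugeField ξ Q (r + 1)) =
      ξ (divergence 1 (gaugeField ξ Q r)) - gaugeField ξ Q r (divergence 0 ξ) := by
  have hbracket := divergence_superBracket hξ (isVectorField_gaugeField hξ hQ r)
  rwa [zero_mul, sgn_zero, one_smul, zero_add, superBracket_zero_one, ← succ_smul_gaugeField,
    divergence_smul] at hbracket

theorem sum_gaugeField_gaugeFun_eq_zero (hξ : IsVectorField 0 2 ξ) (hQ : IsVectorField 1 1 Q)
    (h0 : Q f + (2⁻¹ : k) • divergence 1 Q = 0) (r : ℕ) :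
    ∑ x ∈ Finset.HasAntidiagonal.antidiagonal r, gaugeField ξ Q x.1 (gaugeFun ξ f x.2) +
      (2⁻¹ : k) • divergence 1 (gaugeField ξ Q r) = 0 := by
  have hsum := sum_antidiagonal_eq_zero_of_leibniz (k := k) (F := fun i j =>
    gaugeField ξ Q i (gaugeFun ξ f j) +
      if j = 0 then (2⁻¹ : k) • divergence 1 (gaugeField ξ Q i) else 0) ξ ?_ (fun i j => ?_) r
  · rwa [Finset.sum_add_distrib, Finset.sum_eq_single_of_mem (r, 0)
      (by rw [Finset.HasAntidiagonal.mem_antidiagonal, add_zero])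
      fun x hx hne => if_neg fun h0 => hne (Prod.ext ?_ h0), if_pos rfl] at hsum
    rwa [Finset.HasAntidiagonal.mem_antidiagonal, h0, add_zero] at hx
  · rw [if_pos rfl, gaugeField_zero, gaugeFun, h0]
  · rw [if_neg (Nat.succ_ne_zero j), add_zero, smul_add, ← LinearMap.smul_apply, ← map_smul,
      succ_smul_gaugeField, succ_smul_gaugeFun, map_add, map_add, LinearMap.sub_apply,
      Module.End.mul_apply, Module.End.mul_apply]
    split_ifs
    · rw [smul_comm, succ_smul_divergence_gaugeField hξ hQ, smul_sub, map_smul, map_smul]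
      abel
    · rw [smul_zero, map_zero, map_zero]
      abel

end CharZero

end GaugeSeries

section GaugeAction

variable {k : Type*} [Field k] {l n : ℕ} {D ξ m Q : Module.End k (FormalFun k l n)}
  {f : FormalFun k l n}

/-- The function `f'` in the gauge transform `e^{(ξ, 0)} · (m, Πf) = (m', Πf')`. -/
def gaugeFunSum (ξ : Module.End k (FormalFun k l n)) (f : FormalFun k l n) : FormalFun k l n :=
  seriesSum (gaugeFun ξ f)

/-- The conjugate `e^ξ Q e^{-ξ}`. -/
def gaugeFieldSum (ξ Q : Module.End k (FormalFun k l n)) : Module.End k (FormalFun k l n) :=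
  operatorSum (gaugeField ξ Q)

theorem gaugeFunSum_mem_lengthGE (hξ : IsVectorField 0 2 ξ) (hf : f ∈ lengthGE k l n 1) :
    gaugeFunSum ξ f ∈ lengthGE k l n 1 := by
  have hsub := seriesSum_sub_sum_mem_lengthGE (gaugeFun_mem_lengthGE hξ hf) 1
  rw [Finset.sum_range_one] at hsub
  exact (Submodule.sub_mem_iff_left _ hf).mp hsub

theorem gaugeFunSum_mem_parityPart (hξ : IsVectorField 0 2 ξ) (hf : f ∈ lengthGE k l n 1)
    (h0 : f ∈ parityPart k l n 0) : gaugeFunSum ξ f ∈ parityPart k l n 0 :=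
  seriesSum_mem_parityPart (gaugeFun_mem_lengthGE hξ hf) (gaugeFun_mem_parityPart hξ h0)

theorem gaugeFieldSum_mul_self [CharZero k] (hξ : IsVectorField 0 2 ξ) (hQ : IsVectorField 1 1 Q)
    (h2 : Q * Q = 0) : gaugeFieldSum ξ Q * gaugeFieldSum ξ Q = 0 := by
  have hq := isVectorField_gaugeField hξ hQ
  refine LinearMap.ext fun a => eq_zero_of_forall_mem_lengthGE fun N => ?_
  have hprod :=
    operatorSum_seriesSum_sub_sum_mem_lengthGE hq (fun r => (hq r).apply_mem_lengthGE a) N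
  have hdiag : ∀ r, ∑ x ∈ Finset.HasAntidiagonal.antidiagonal r,
      gaugeField ξ Q x.1 (gaugeField ξ Q x.2 a) = 0 := fun r => by
    simpa only [LinearMap.sum_apply, Module.End.mul_apply, LinearMap.zero_apply] using
      LinearMap.congr_fun (sum_gaugeField_mul_eq_zero (ξ := ξ) h2 r) a
  rwa [Finset.sum_eq_zero fun r _ => hdiag r, sub_zero] at hprod

theorem gaugeFieldSum_gaugeFunSum [CharZero k] (hξ : IsVectorField 0 2 ξ)
    (hQ : IsVectorField 1 1 Q) (hf : f ∈ lengthGE k l n 1)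
    (h0 : Q f + (2⁻¹ : k) • divergence 1 Q = 0) :
    gaugeFieldSum ξ Q (gaugeFunSum ξ f) + (2⁻¹ : k) • divergence 1 (gaugeFieldSum ξ Q) = 0 := by
  have hq := isVectorField_gaugeField hξ hQ
  refine eq_zero_of_forall_mem_lengthGE fun N => ?_
  have hprod := operatorSum_seriesSum_sub_sum_mem_lengthGE hq (gaugeFun_mem_lengthGE hξ hf) N
  have hdiv := (isVectorField_operatorSum_sub_sum hq N).divergence_mem_lengthGE
  have hdiag : ∑ r ∈ Finset.range N, ∑ x ∈ Finset.HasAntidiagonal.antidiagonal r,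
      gaugeField ξ Q x.1 (gaugeFun ξ f x.2) =
        -((2⁻¹ : k) • divergence 1 (∑ r ∈ Finset.range N, gaugeField ξ Q r)) := by
    rw [Finset.sum_congr rfl fun r _ =>
      eq_neg_of_add_eq_zero_left (sum_gaugeField_gaugeFun_eq_zero hξ hQ h0 r)]
    rw [Finset.sum_neg_distrib, ← Finset.smul_sum, divergence_sum]
  have hsum := add_mem hprod (Submodule.smul_mem _ (2⁻¹ : k) hdiv)
  rwa [hdiag, divergence_sub, smul_sub, sub_neg_eq_add, add_add_sub_cancel] at hsum

theorem bracket_iterate (ξ η : Module.End k (FormalFun k l n)) (g : FormalFun k l n) (r : ℕ) :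
    (bracket 0 1 (ξ, (0 : FormalFun k l n)))^[r] (η, g) =
      ((superBracket 0 1 ξ)^[r] η, (ξ ^ r) g) := by
  induction r with
  | zero => rfl
  | succ r ih =>
    rw [Function.iterate_succ_apply', ih, Function.iterate_succ_apply', pow_succ', bracket,
      map_zero, smul_zero, sub_zero, Module.End.mul_apply]

theorem gaugePartialSum_eq (D ξ m : Module.End k (FormalFun k l n)) (f : FormalFun k l n) (N : ℕ) :
    gaugePartialSum D (ξ, 0) (m, f) N =
      (∑ r ∈ Finset.range (N + 1), gaugeField ξ (D + m) r - D,
        ∑ r ∈ Finset.range (N + 1), gaugeFun ξ f r) := by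
  have hfirst : bracket 0 1 (ξ, 0) (m, f) - differential D 0 (ξ, 0) =
      (superBracket 0 1 ξ (D + m), ξ f + (2⁻¹ : k) • divergence 0 ξ) := by
    refine Prod.ext ?_ ?_
    · simp only [bracket, differential, superBracket, Prod.fst_sub, zero_mul, mul_zero, sgn_zero,
        one_smul, mul_add, add_mul]
      abel
    · simp only [bracket, differential, Prod.snd_sub, map_zero, smul_zero, sub_zero, sgn_zero,
        one_smul, zero_sub, sub_neg_eq_add]
  rw [gaugePartialSum, hfirst]
  simp only [bracket_iterate]
  rw [Finset.sum_range_succ', Finset.sum_range_succ', gaugeField_zero]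
  refine Prod.ext ?_ ?_
  · simp only [Prod.fst_add, Prod.fst_sum, Prod.smul_fst, gaugeField, Function.iterate_succ_apply]
    abel
  · rw [Prod.snd_add, Prod.snd_sum, add_comm]
    rfl

-- `[D, m] + ½[m, m] = (D + m)² - D²`
theorem isUnimodular_iff_add_mul_add_eq_zero [CharZero k] (hDD : D * D = 0)
    (hdiv : divergence 1 D = 0) : IsUnimodular D m f ↔ IsVectorField 1 2 m ∧
      f ∈ parityPart k l n 0 ∧ f ∈ lengthGE k l n 1 ∧ (D + m) * (D + m) = 0 ∧
      (D + m) f + (2⁻¹ : k) • divergence 1 (D + m) = 0 := by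
  have hfield : superBracket 1 1 D m + (2⁻¹ : k) • superBracket 1 1 m m = (D + m) * (D + m) := by
    rw [superBracket_one_one, superBracket_one_one, ← two_smul k (m * m), smul_smul,
      inv_mul_cancel₀ two_ne_zero, one_smul, mul_add, add_mul, add_mul, hDD]
    abel
  have hfun : D f + (2⁻¹ : k) • divergence 1 m + m f =
      (D + m) f + (2⁻¹ : k) • divergence 1 (D + m) := by
    rw [divergence_add, hdiv, zero_add, LinearMap.add_apply, add_right_comm]
  rw [← hfield, ← hfun]
  exact ⟨fun h => ⟨h.1, h.2, h.3, h.4, h.5⟩, fun h => ⟨h.1, h.2.1, h.2.2.1, h.2.2.2.1, h.2.2.2.2⟩⟩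

theorem isVectorField_gaugeFieldSum_sub (hξ : IsVectorField 0 2 ξ) (hQ : IsVectorField 1 1 Q) :
    IsVectorField 1 2 (gaugeFieldSum ξ Q - Q) := by
  have hsub := isVectorField_operatorSum_sub_sum (isVectorField_gaugeField hξ hQ) 1
  rwa [Finset.sum_range_one, gaugeField_zero] at hsub

theorem IsUnimodular.gauge [CharZero k] (hD : IsVectorField 1 1 D) (hDD : D * D = 0)
    (hdiv : divergence 1 D = 0) (h : IsUnimodular D m f) (hξ : IsVectorField 0 2 ξ) :
    IsUnimodular D (gaugeFieldSum ξ (D + m) - D) (gaugeFunSum ξ f) := by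
  obtain ⟨hm, hf0, hf1, hQQ, hQf⟩ := (isUnimodular_iff_add_mul_add_eq_zero hDD hdiv).mp h
  have hQ : IsVectorField 1 1 (D + m) := hD.add (hm.mono (by omega))
  refine (isUnimodular_iff_add_mul_add_eq_zero hDD hdiv).mpr ⟨?_, gaugeFunSum_mem_parityPart hξ hf1
    hf0, gaugeFunSum_mem_lengthGE hξ hf1, ?_, ?_⟩
  · have hadd := (isVectorField_gaugeFieldSum_sub hξ hQ).add hm
    rwa [← sub_sub, sub_add_cancel] at hadd
  · rw [add_sub_cancel, gaugeFieldSum_mul_self hξ hQ hQQ]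
  · rw [add_sub_cancel, gaugeFieldSum_gaugeFunSum hξ hQ hf1 hQf]

theorem gaugeEquiv_gauge (hD : IsVectorField 1 1 D) (hm : IsVectorField 1 1 m)
    (hf0 : f ∈ parityPart k l n 0) (hf1 : f ∈ lengthGE k l n 1) (hξ : IsVectorField 0 2 ξ) :
    GaugeEquiv D (m, f) (gaugeFieldSum ξ (D + m) - D, gaugeFunSum ξ f) := by
  refine ⟨(ξ, 0), ⟨hξ, zero_mem _, zero_mem _⟩, fun p => ?_⟩
  filter_upwards [Filter.eventually_ge_atTop p] with N hN
  rw [gaugePartialSum_eq, Prod.mk_sub_mk, sub_sub_sub_cancel_right]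
  refine ⟨?_, ?_, ?_⟩
  · exact (isVectorField_operatorSum_sub_sum (isVectorField_gaugeField hξ (hD.add hm))
      (N + 1)).mono (by omega)
  · exact sub_mem (gaugeFunSum_mem_parityPart hξ hf1 hf0)
      (sum_mem fun r _ => gaugeFun_mem_parityPart hξ hf0 r)
  · exact lengthGE_anti (by omega)
      (seriesSum_sub_sum_mem_lengthGE (gaugeFun_mem_lengthGE hξ hf1) (N + 1))

end GaugeAction

section FixedPoint

variable {k : Type*} [Field k] {l n p : ℕ} {ξ η : Module.End k (FormalFun k l n)}
  {f : FormalFun k l n}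

theorem exists_fixedPoint_of_contracting {W : Set (FormalFun k l n)}
    {F : FormalFun k l n → FormalFun k l n}
    (hclosed : ∀ b, (∀ N, ∃ c ∈ W, b - c ∈ lengthGE k l n N) → b ∈ W) (hne : W.Nonempty)
    (hmaps : Set.MapsTo F W W) (hcontr : ∀ u ∈ W, ∀ v ∈ W, ∀ p, u - v ∈ lengthGE k l n p →
      F u - F v ∈ lengthGE k l n (p + 1)) :
    ∃ u ∈ W, F u = u := by
  obtain ⟨u₀, hu₀⟩ := hne
  have hiter : ∀ r, F^[r] u₀ ∈ W := fun r => hmaps.iterate r hu₀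
  have hstep : ∀ r, F^[r + 1] u₀ - F^[r] u₀ ∈ lengthGE k l n r := fun r => by
    induction r with
    | zero => exact mem_lengthGE_zero _
    | succ r ih =>
      have hnext := hcontr _ (hiter (r + 1)) _ (hiter r) r ih
      rwa [← Function.iterate_succ_apply' F, ← Function.iterate_succ_apply' F] at hnext
  let u := seriesSum (fun r => F^[r + 1] u₀ - F^[r] u₀) + u₀
  have hlim : ∀ N, u - F^[N] u₀ ∈ lengthGE k l n N := fun N => by
    have hseries := seriesSum_sub_sum_mem_lengthGE hstep N
    rwa [Finset.sum_range_sub (fun r => F^[r] u₀), Function.iterate_zero, id, sub_sub_eq_add_sub]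
      at hseries
  have hu : u ∈ W := hclosed u fun N => ⟨_, hiter N, hlim N⟩
  refine ⟨u, hu, sub_eq_zero.mp (eq_zero_of_forall_mem_lengthGE fun N => ?_)⟩
  have himage := hcontr u hu _ (hiter N) N (hlim N)
  rw [← Function.iterate_succ_apply' F] at himage
  have hsub := sub_mem himage (hlim (N + 1))
  rw [sub_sub_sub_cancel_right] at hsub
  exact lengthGE_anti (Nat.le_succ N) hsub

theorem gaugeFun_one : gaugeFun ξ f 1 = ξ f + (2⁻¹ : k) • divergence 0 ξ := by
  rw [gaugeFun, zero_add, Nat.factorial_one, Nat.cast_one, inv_one, one_smul, pow_zero,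
    Module.End.one_apply]

theorem gaugeFun_one_sub_gaugeFun_one : gaugeFun ξ f 1 - gaugeFun η f 1 =
    (ξ - η) f + (2⁻¹ : k) • divergence 0 (ξ - η) := by
  rw [gaugeFun_one, gaugeFun_one, divergence_sub, LinearMap.sub_apply, smul_sub,
    add_sub_add_comm]

theorem gaugeFun_succ_sub_mem_lengthGE (hξ : IsVectorField 0 2 ξ) (hη : IsVectorField 0 2 η)
    (hsub : IsVectorField 0 (p + 1) (ξ - η)) (hf : f ∈ lengthGE k l n 1) (r : ℕ) :
    gaugeFun ξ f (r + 1) - gaugeFun η f (r + 1) ∈ lengthGE k l n (p + r) := by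
  rw [gaugeFun, gaugeFun, ← smul_sub]
  refine Submodule.smul_mem _ _ ?_
  induction r with
  | zero =>
    simp only [pow_zero, Module.End.one_apply]
    rw [← gaugeFun_one, ← gaugeFun_one, gaugeFun_one_sub_gaugeFun_one]
    exact hsub.apply_add_divergence_mem_lengthGE hf
  | succ r ih =>
    have hpow := hη.pow_apply_mem_lengthGE (hη.apply_add_divergence_mem_lengthGE hf) r
    rw [pow_succ', pow_succ', Module.End.mul_apply, Module.End.mul_apply]
    set a := (ξ ^ r) (ξ f + (2⁻¹ : k) • divergence 0 ξ)
    set b := (η ^ r) (η f + (2⁻¹ : k) • divergence 0 η)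
    have hsplit : ξ a - η b = ξ (a - b) + (ξ - η) b := by
      rw [map_sub, LinearMap.sub_apply, sub_add_sub_cancel]
    rw [hsplit]
    exact add_mem (hξ.map_lengthGE (by omega) ih) (hsub.map_lengthGE (by omega) hpow)

theorem gaugeFunSum_sub_mem_lengthGE (hξ : IsVectorField 0 2 ξ) (hη : IsVectorField 0 2 η)
    (hsub : IsVectorField 0 (p + 1) (ξ - η)) (hf : f ∈ lengthGE k l n 1) :
    gaugeFunSum ξ f - gaugeFunSum η f - (2⁻¹ : k) • divergence 0 (ξ - η) ∈
      lengthGE k l n (p + 1) := by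
  have hξsum := seriesSum_sub_sum_mem_lengthGE (gaugeFun_mem_lengthGE hξ hf) (p + 2)
  have hηsum := seriesSum_sub_sum_mem_lengthGE (gaugeFun_mem_lengthGE hη hf) (p + 2)
  have hpartial : ∑ r ∈ Finset.range (p + 2), (gaugeFun ξ f r - gaugeFun η f r) -
      (2⁻¹ : k) • divergence 0 (ξ - η) ∈ lengthGE k l n (p + 1) := by
    rw [Finset.sum_range_succ', Finset.sum_range_succ', zero_add, gaugeFun_one_sub_gaugeFun_one,
      gaugeFun, gaugeFun, sub_self, add_zero, ← add_assoc, add_sub_cancel_right]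
    refine add_mem (sum_mem fun r _ => ?_) (hsub.map_lengthGE (by omega) hf)
    exact lengthGE_anti (by omega) (gaugeFun_succ_sub_mem_lengthGE hξ hη hsub hf (r + 1))
  have hsum := add_mem (lengthGE_anti (Nat.le_succ _) (sub_mem hξsum hηsum)) hpartial
  rw [Finset.sum_sub_distrib] at hsum
  convert hsum using 1
  rw [gaugeFunSum, gaugeFunSum]
  abel

end FixedPoint

section DivergenceSection

variable {k : Type*} [Field k] {l n : ℕ} {f : FormalFun k l n}

/-- `s` is a right inverse of the divergence, on even functions and compatibly with the length
filtrations, up to the error `τ`: `∇(s u) = u - τ u`. -/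
structure IsDivergenceSection (s : FormalFun k l n →ₗ[k] Module.End k (FormalFun k l n))
    (τ : Module.End k (FormalFun k l n)) : Prop where
  isVectorField : ∀ p, ∀ u ∈ parityPart k l n 0, u ∈ lengthGE k l n p →
    IsVectorField 0 (p + 1) (s u)
  divergence_eq : ∀ u ∈ parityPart k l n 0, divergence 0 (s u) = u - τ u

variable {s : FormalFun k l n →ₗ[k] Module.End k (FormalFun k l n)}
  {τ : Module.End k (FormalFun k l n)}

theorem mem_of_approx_parityPart_inf_lengthGE {i : ZMod 2} {p : ℕ} {b : FormalFun k l n}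
    (h : ∀ N, ∃ c ∈ parityPart k l n i ⊓ lengthGE k l n p, b - c ∈ lengthGE k l n N) :
    b ∈ parityPart k l n i ⊓ lengthGE k l n p := by
  refine ⟨mem_parityPart_of_approx fun N => ?_, ?_⟩
  · obtain ⟨c, hc, hbc⟩ := h N
    exact ⟨c, hc.1, hbc⟩
  · obtain ⟨c, hc, hbc⟩ := h p
    exact (Submodule.sub_mem_iff_left _ hc.2).mp hbc

-- The equation `gaugeFunSum (s u) f = -½ τ u` says that `u` is fixed by the contraction
-- `u ↦ ∇(s u) - 2 gaugeFunSum (s u) f`.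
theorem IsDivergenceSection.exists_gaugeFunSum_eq [CharZero k] (h : IsDivergenceSection s τ)
    (hf : f ∈ lengthGE k l n 1) (h0 : f ∈ parityPart k l n 0) :
    ∃ ξ u, IsVectorField 0 2 ξ ∧ gaugeFunSum ξ f = τ u := by
  let W := parityPart k l n 0 ⊓ lengthGE k l n 1
  let F : FormalFun k l n → FormalFun k l n :=
    fun u => divergence 0 (s u) - (2 : k) • gaugeFunSum (s u) f
  have hmaps : Set.MapsTo F W W := fun u hu => by
    have hs := h.isVectorField 1 u hu.1 hu.2
    exact ⟨sub_mem hs.divergence_mem_parityPart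
        (Submodule.smul_mem _ _ (gaugeFunSum_mem_parityPart hs hf h0)),
      sub_mem hs.divergence_mem_lengthGE
        (Submodule.smul_mem _ _ (gaugeFunSum_mem_lengthGE hs hf))⟩
  have hcontr : ∀ u ∈ W, ∀ v ∈ W, ∀ p, u - v ∈ lengthGE k l n p →
      F u - F v ∈ lengthGE k l n (p + 1) := fun u hu v hv p huv => by
    have hsub : IsVectorField 0 (p + 1) (s u - s v) := by
      rw [← map_sub]
      exact h.isVectorField p _ (sub_mem hu.1 hv.1) huv
    have hF : F u - F v = (-2 : k) • (gaugeFunSum (s u) f - gaugeFunSum (s v) f -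
        (2⁻¹ : k) • divergence 0 (s u - s v)) := by
      rw [smul_sub, smul_smul, neg_mul, mul_inv_cancel₀ two_ne_zero, divergence_sub]
      module
    rw [hF]
    exact Submodule.smul_mem _ _ (gaugeFunSum_sub_mem_lengthGE (h.isVectorField 1 u hu.1 hu.2)
      (h.isVectorField 1 v hv.1 hv.2) hsub hf)
  obtain ⟨u, hu, hfixed⟩ := exists_fixedPoint_of_contracting (W := (W : Set (FormalFun k l n)))
    (fun _ => mem_of_approx_parityPart_inf_lengthGE) ⟨0, zero_mem W⟩ hmaps hcontr
  refine ⟨s u, -((2⁻¹ : k) • u), h.isVectorField 1 u hu.1 hu.2, ?_⟩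
  change divergence 0 (s u) - (2 : k) • gaugeFunSum (s u) f = u at hfixed
  rw [h.divergence_eq u hu.1, sub_sub, sub_eq_self] at hfixed
  rw [map_neg, map_smul, eq_neg_of_add_eq_zero_left hfixed, smul_neg, neg_neg, smul_smul,
    inv_mul_cancel₀ two_ne_zero, one_smul]

theorem IsDivergenceSection.exists_gaugeEquiv [CharZero k] {D m : Module.End k (FormalFun k l n)}
    (h : IsDivergenceSection s τ) (hD : IsVectorField 1 1 D) (hDD : D * D = 0)
    (hdiv : divergence 1 D = 0) (hmf : IsUnimodular D m f) :
    ∃ m' u, IsUnimodular D m' (τ u) ∧ GaugeEquiv D (m, f) (m', τ u) := by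
  obtain ⟨ξ, u, hξ, hu⟩ := h.exists_gaugeFunSum_eq hmf.lengthGE_one hmf.even
  have hgauge := hmf.gauge hD hDD hdiv hξ
  have hequiv :=
    gaugeEquiv_gauge hD (hmf.isVectorField.mono one_le_two) hmf.even hmf.lengthGE_one hξ
  rw [hu] at hgauge hequiv
  exact ⟨_, u, hgauge, hequiv⟩

/-- The linear map sending `a` to the vector field `φ(a) ∂_z`. -/
def coordField (φ : Module.End k (FormalFun k l n)) (z : CoordIdx l n) :
    FormalFun k l n →ₗ[k] Module.End k (FormalFun k l n) :=
  LinearMap.mulRight k (partialCoord k z) ∘ₗ LinearMap.mul k (FormalFun k l n) ∘ₗ φ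

theorem coordField_apply (φ : Module.End k (FormalFun k l n)) (z : CoordIdx l n)
    (a : FormalFun k l n) : coordField φ z a = LinearMap.mulLeft k (φ a) * partialCoord k z := rfl

/-- Formal integration in the variable `y_t`. The coefficients of the integral at the exponents
with `e t = 0` vanish because `0⁻¹ = 0`. -/
def integralEven (t : Fin n) : Module.End k (FormalFun k l n) where
  toFun a := fun e => (e t : k)⁻¹ • MvPowerSeries.coeff (e - Finsupp.single t 1) a
  map_add' a b := by
    ext e
    change (e t : k)⁻¹ • MvPowerSeries.coeff (e - Finsupp.single t 1) (a + b) = _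
    rw [map_add, smul_add]
    rfl
  map_smul' c a := by
    ext e
    exact smul_comm (e t : k)⁻¹ c (MvPowerSeries.coeff (e - Finsupp.single t 1) a)

theorem coeff_integralEven (t : Fin n) (a : FormalFun k l n) (e : Fin n →₀ ℕ) :
    MvPowerSeries.coeff e (integralEven t a) =
      (e t : k)⁻¹ • MvPowerSeries.coeff (e - Finsupp.single t 1) a := rfl

theorem partialEven_integralEven [CharZero k] (t : Fin n) (a : FormalFun k l n) :
    partialEven t (integralEven t a) = a := by
  ext e
  rw [coeff_partialEven, coeff_integralEven, add_tsub_cancel_right, smul_smul, Finsupp.add_apply,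
    Finsupp.single_eq_same, Nat.cast_add, Nat.cast_one,
    mul_inv_cancel₀ (Nat.cast_add_one_ne_zero (e t)), one_smul]

theorem integralEven_mem_parityPart (t : Fin n) {i : ZMod 2} {a : FormalFun k l n}
    (ha : a ∈ parityPart k l n i) : integralEven t a ∈ parityPart k l n i := fun _ =>
  Submodule.smul_mem _ _ (ha _)

theorem integralEven_mem_lengthGE (t : Fin n) {p : ℕ} {a : FormalFun k l n}
    (ha : a ∈ lengthGE k l n p) : integralEven t a ∈ lengthGE k l n (p + 1) :=
  mem_lengthGE_iff.mpr fun e => by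
    rw [coeff_integralEven]
    by_cases h : e t = 0
    · rw [h, Nat.cast_zero, inv_zero, zero_smul]
      exact zero_mem _
    · have hdegree := congrArg Finsupp.degree (sub_single_add_single h)
      rw [map_add, Finsupp.degree_single] at hdegree
      exact Submodule.smul_mem _ _ (exteriorGE_anti (by omega) (mem_lengthGE_iff.mp ha _))

theorem isDivergenceSection_integralEven [CharZero k] (t : Fin n) :
    IsDivergenceSection (coordField (integralEven t : Module.End k (FormalFun k l n)) (Sum.inl t))
      0 where
  isVectorField _ _ hu hup := isVectorField_mulLeft_partialCoord
    (integralEven_mem_parityPart t hu) (integralEven_mem_lengthGE t hup)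
  divergence_eq u _ := by
    rw [coordField_apply, divergence_mulLeft_partialCoord, coordParity, Sum.elim_inl, mul_zero,
      sgn_zero, one_smul, LinearMap.zero_apply, sub_zero]
    exact partialEven_integralEven t u

/-- The operator `x_t ∂/∂x_t`. -/
def eulerOdd (t : Fin l) : Module.End k (FormalFun k l n) :=
  LinearMap.mulLeft k (oddCoord t) * partialOdd t

theorem partialOdd_oddCoord_mul (t : Fin l) (a : FormalFun k l n) :
    partialOdd t (oddCoord t * a) = a - eulerOdd t a := by
  rw [partialOdd_mul t (oddCoord_mem_parityPart t), partialOdd_oddCoord, if_pos rfl, one_mul,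
    sgn_one, neg_one_smul, ← sub_eq_add_neg]
  rfl

theorem isDivergenceSection_zero : IsDivergenceSection
    (0 : FormalFun k l n →ₗ[k] Module.End k (FormalFun k l n)) 1 where
  isVectorField _ _ _ _ := isVectorField_zero
  divergence_eq u _ := by
    rw [LinearMap.zero_apply, divergence_zero, Module.End.one_apply, sub_self]

theorem IsDivergenceSection.add_coordField (h : IsDivergenceSection s τ) (t : Fin l) :
    IsDivergenceSection (s - coordField (LinearMap.mulLeft k (oddCoord t) * τ) (Sum.inr t))
      (eulerOdd t * τ) where
  isVectorField p u hu hup := by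
    have hτ : τ u = u - divergence 0 (s u) := by rw [h.divergence_eq u hu, sub_sub_cancel]
    have hs := h.isVectorField p u hu hup
    have hparity : oddCoord t * τ u ∈ parityPart k l n (0 + 1) := by
      rw [hτ, add_comm]
      exact mul_mem_parityPart (oddCoord_mem_parityPart t) (sub_mem hu hs.divergence_mem_parityPart)
    have hlength : oddCoord t * τ u ∈ lengthGE k l n (p + 1) := by
      rw [hτ, add_comm p]
      exact mul_mem_lengthGE (oddCoord_mem_lengthGE t) (sub_mem hup hs.divergence_mem_lengthGE)
    exact hs.sub (isVectorField_mulLeft_partialCoord hparity hlength)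
  divergence_eq u hu := by
    have hcoord : divergence 0 (coordField (LinearMap.mulLeft k (oddCoord t) * τ) (Sum.inr t) u) =
        -partialOdd t (oddCoord t * τ u) := by
      rw [coordField_apply, divergence_mulLeft_partialCoord, coordParity, Sum.elim_inr, zero_add,
        mul_one, sgn_one, neg_one_smul]
      rfl
    rw [LinearMap.sub_apply, divergence_sub, hcoord, h.divergence_eq u hu, partialOdd_oddCoord_mul,
      Module.End.mul_apply]
    abel

theorem exists_isDivergenceSection_prod_eulerOdd (L : List (Fin l)) :
    ∃ s : FormalFun k l n →ₗ[k] Module.End k (FormalFun k l n),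
      IsDivergenceSection s (L.map eulerOdd).prod := by
  induction L with
  | nil => exact ⟨0, isDivergenceSection_zero⟩
  | cons t L ih =>
    obtain ⟨s, hs⟩ := ih
    rw [List.map_cons, List.prod_cons]
    exact ⟨_, hs.add_coordField t⟩

end DivergenceSection

section TopMonomial

variable {k : Type*} [Field k] {l n : ℕ} {i j : ZMod 2}

theorem eq_zero_of_mem_parityPart_of_ne {a : FormalFun k l n} (hij : i ≠ j)
    (hi : a ∈ parityPart k l n i) (hj : a ∈ parityPart k l n j) : a = 0 := by
  ext e
  by_contra h
  exact hij (DirectSum.degree_eq_of_mem_mem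
    (CliffordAlgebra.evenOdd (0 : QuadraticForm k (Fin l → k))) (hi e) (hj e) h)

theorem prod_oddCoord_mem_parityPart (L : List (Fin l)) :
    (L.map oddCoord).prod ∈ parityPart k l n (L.length : ZMod 2) := by
  induction L with
  | nil => exact one_mem_parityPart
  | cons t L ih =>
    rw [List.map_cons, List.prod_cons, List.length_cons, Nat.cast_add, Nat.cast_one, add_comm]
    exact mul_mem_parityPart (oddCoord_mem_parityPart t) ih

theorem prod_oddCoord_mem_lengthGE (L : List (Fin l)) :
    (L.map oddCoord).prod ∈ lengthGE k l n L.length := by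
  induction L with
  | nil => exact mem_lengthGE_zero _
  | cons t L ih =>
    rw [List.map_cons, List.prod_cons, List.length_cons, add_comm]
    exact mul_mem_lengthGE (oddCoord_mem_lengthGE t) ih

theorem topMonomial_eq_prod_map : topMonomial k l n = ((List.finRange l).map oddCoord).prod := by
  rw [topMonomial, List.ofFn_eq_map]

theorem topMonomial_mem_parityPart : topMonomial k l n ∈ parityPart k l n (l : ZMod 2) := by
  have h := prod_oddCoord_mem_parityPart (k := k) (n := n) (List.finRange l)
  rwa [← topMonomial_eq_prod_map, List.length_finRange] at h

theorem topMonomial_mem_lengthGE : topMonomial k l n ∈ lengthGE k l n l := by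
  have h := prod_oddCoord_mem_lengthGE (k := k) (n := n) (List.finRange l)
  rwa [← topMonomial_eq_prod_map, List.length_finRange] at h

theorem partialOdd_prod_oddCoord {t : Fin l} {L : List (Fin l)} (h : t ∉ L) :
    partialOdd t (L.map (oddCoord (k := k) (n := n))).prod = 0 := by
  induction L with
  | nil => exact (isVectorField_partialOdd t).map_one
  | cons s L ih =>
    rw [List.mem_cons, not_or] at h
    rw [List.map_cons, List.prod_cons, partialOdd_mul t (oddCoord_mem_parityPart s), ih h.2,
      partialOdd_oddCoord, if_neg h.1, zero_mul, mul_zero, smul_zero, add_zero]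

theorem eulerOdd_apply (t : Fin l) (a : FormalFun k l n) :
    eulerOdd t a = oddCoord t * partialOdd t a := rfl

theorem exists_prod_eulerOdd_eq_prod_oddCoord_mul {L : List (Fin l)} (h : L.Nodup)
    (a : FormalFun k l n) : ∃ b, (L.map eulerOdd).prod a = (L.map oddCoord).prod * b := by
  induction L with
  | nil => exact ⟨a, (one_mul a).symm⟩
  | cons t L ih =>
    rw [List.nodup_cons] at h
    obtain ⟨b, hb⟩ := ih h.2
    refine ⟨sgn k (L.length : ZMod 2) • partialOdd t b, ?_⟩
    rw [List.map_cons, List.prod_cons, Module.End.mul_apply, hb, eulerOdd_apply,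
      partialOdd_mul t (prod_oddCoord_mem_parityPart L), partialOdd_prod_oddCoord h.1, zero_mul,
      zero_add, List.map_cons, List.prod_cons, mul_smul_comm, mul_smul_comm, mul_assoc]

theorem eq_zero_of_mem_lengthGE_succ {a : FormalFun k l 0} (ha : a ∈ lengthGE k l 0 (l + 1)) :
    a = 0 := by
  ext e
  rw [Subsingleton.elim e 0, map_zero]
  exact coeff_eq_zero_of_mem_lengthGE ha (by rw [map_zero]; omega)

theorem exists_prod_eulerOdd_eq_smul_topMonomial (a : FormalFun k l 0) :
    ∃ c : k, ((List.finRange l).map eulerOdd).prod a = c • topMonomial k l 0 := by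
  obtain ⟨b, hb⟩ := exists_prod_eulerOdd_eq_prod_oddCoord_mul (List.nodup_finRange l) a
  obtain ⟨c, hc⟩ := exists_sub_smul_one_mem_lengthGE b
  have hzero := eq_zero_of_mem_lengthGE_succ (mul_mem_lengthGE topMonomial_mem_lengthGE hc)
  rw [mul_sub, mul_smul_comm, mul_one, sub_eq_zero] at hzero
  exact ⟨c, by rw [hb, ← topMonomial_eq_prod_map, hzero]⟩

theorem eulerOdd_eq_self (t : Fin l) {a : FormalFun k l 0} (ha : a ∈ lengthGE k l 0 l) :
    eulerOdd t a = a := by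
  have hzero : oddCoord t * a = 0 := eq_zero_of_mem_lengthGE_succ
    (add_comm 1 l ▸ mul_mem_lengthGE (oddCoord_mem_lengthGE t) ha)
  have h := partialOdd_oddCoord_mul t a
  rw [hzero, map_zero, eq_comm, sub_eq_zero] at h
  exact h.symm

theorem exists_eq_smul_topMonomial {a : FormalFun k l 0} (ha : a ∈ lengthGE k l 0 l) :
    ∃ c : k, a = c • topMonomial k l 0 := by
  have hprod : ∀ L : List (Fin l), (L.map eulerOdd).prod a = a := fun L => by
    induction L with
    | nil => rfl
    | cons t L ih =>
      rw [List.map_cons, List.prod_cons, Module.End.mul_apply, ih, eulerOdd_eq_self t ha]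
  obtain ⟨c, hc⟩ := exists_prod_eulerOdd_eq_smul_topMonomial a
  exact ⟨c, by rw [← hc, hprod]⟩

theorem IsVectorField.apply_topMonomial_eq_zero {ξ : Module.End k (FormalFun k l 0)}
    (h : IsVectorField 1 1 ξ) : ξ (topMonomial k l 0) = 0 := by
  obtain ⟨c, hc⟩ := exists_eq_smul_topMonomial (h.map_lengthGE le_rfl topMonomial_mem_lengthGE)
  have hparity := h.map_parity _ _ topMonomial_mem_parityPart
  refine eq_zero_of_mem_parityPart_of_ne (by simp) hparity (j := (l : ZMod 2)) ?_
  rw [hc]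
  exact Submodule.smul_mem _ c topMonomial_mem_parityPart

theorem IsUnimodular.zero_of_smul_topMonomial {D m : Module.End k (FormalFun k l 0)} {c : k}
    (hD : IsVectorField 1 1 D) (h : IsUnimodular D m (c • topMonomial k l 0)) :
    IsUnimodular D m 0 where
  isVectorField := h.isVectorField
  even := zero_mem _
  lengthGE_one := zero_mem _
  mc_field := h.mc_field
  mc_function := by
    have hdiv := h.mc_function
    rw [map_smul, map_smul, hD.apply_topMonomial_eq_zero,
      (h.isVectorField.mono one_le_two).apply_topMonomial_eq_zero, smul_zero] at hdiv
    rwa [map_zero, map_zero]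

end TopMonomial

section LinearField

variable {k : Type*} [Field k] {V₀ V₁ : Type*} [AddCommGroup V₀] [Module k V₀]
  [AddCommGroup V₁] [Module k V₁] {l n : ℕ} (b₀ : Module.Basis (Fin l) k V₀)
  (b₁ : Module.Basis (Fin n) k V₁) (d₀ : V₀ →ₗ[k] V₁) (d₁ : V₁ →ₗ[k] V₀)

theorem isVectorField_linearField : IsVectorField 1 1 (linearField b₀ b₁ d₀ d₁) := by
  refine IsVectorField.add (IsVectorField.sum _ fun t _ => ?_) (IsVectorField.sum _ fun t _ => ?_)
  · exact isVectorField_mulLeft_partialCoord (z := Sum.inl t)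
      (sum_mem fun s _ => Submodule.smul_mem _ _ (coord_mem_parityPart (Sum.inr s)))
      (sum_mem fun s _ => Submodule.smul_mem _ _ (coord_mem_lengthGE (Sum.inr s)))
  · exact isVectorField_mulLeft_partialCoord (z := Sum.inr t)
      (sum_mem fun s _ => Submodule.smul_mem _ _ (coord_mem_parityPart (Sum.inl s)))
      (sum_mem fun s _ => Submodule.smul_mem _ _ (coord_mem_lengthGE (Sum.inl s)))

theorem linearField_evenCoord (t : Fin n) : linearField b₀ b₁ d₀ d₁ (evenCoord t) =
    ∑ s, b₁.coord t (d₀ (b₀ s)) • (oddCoord s : FormalFun k l n) := by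
  simp [linearField, LinearMap.sum_apply, partialEven_evenCoord, partialOdd_evenCoord]

theorem linearField_oddCoord (t : Fin l) : linearField b₀ b₁ d₀ d₁ (oddCoord t) =
    ∑ s, b₀.coord t (d₁ (b₁ s)) • (evenCoord s : FormalFun k l n) := by
  simp [linearField, LinearMap.sum_apply, partialEven_oddCoord, partialOdd_oddCoord]

theorem divergence_linearField : divergence 1 (linearField b₀ b₁ d₀ d₁) = 0 := by
  simp [divergence, linearField_evenCoord, linearField_oddCoord, partialEven_oddCoord,
    partialOdd_evenCoord]

theorem sum_coord_mul_coord_eq_zero {V W ι κ : Type*} [AddCommGroup V] [Module k V]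
    [AddCommGroup W] [Module k W] [Fintype ι] {u : V →ₗ[k] W} {v : W →ₗ[k] V} (h : u ∘ₗ v = 0)
    (b : Module.Basis ι k V) (c : Module.Basis κ k W) (s t : κ) :
    ∑ i, b.coord i (v (c t)) * c.coord s (u (b i)) = 0 := by
  have hst := congrArg (c.coord s) (LinearMap.congr_fun h (c t))
  rw [LinearMap.comp_apply, ← b.sum_repr (v (c t)), map_sum, map_sum] at hst
  simpa only [map_smul, smul_eq_mul, LinearMap.zero_apply, map_zero,
    Module.Basis.coord_apply] using hst

theorem linearField_mul_self (hd₀ : d₁ ∘ₗ d₀ = 0) (hd₁ : d₀ ∘ₗ d₁ = 0) :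
    linearField b₀ b₁ d₀ d₁ * linearField b₀ b₁ d₀ d₁ = 0 := by
  refine ((isVectorField_linearField b₀ b₁ d₀ d₁).mul_self (r := 1) le_rfl).eq_zero ?_
  rintro (t | t)
  · change linearField b₀ b₁ d₀ d₁ (linearField b₀ b₁ d₀ d₁ (evenCoord t)) = 0
    simp only [linearField_evenCoord, map_sum, map_smul, linearField_oddCoord, Finset.smul_sum,
      smul_smul]
    rw [Finset.sum_comm]
    refine Finset.sum_eq_zero fun s _ => ?_
    simp_rw [mul_comm (b₁.coord t _)]
    rw [← Finset.sum_smul, sum_coord_mul_coord_eq_zero hd₁, zero_smul]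
  · change linearField b₀ b₁ d₀ d₁ (linearField b₀ b₁ d₀ d₁ (oddCoord t)) = 0
    simp only [linearField_oddCoord, map_sum, map_smul, linearField_evenCoord, Finset.smul_sum,
      smul_smul]
    rw [Finset.sum_comm]
    refine Finset.sum_eq_zero fun s _ => ?_
    simp_rw [mul_comm (b₀.coord t _)]
    rw [← Finset.sum_smul, sum_coord_mul_coord_eq_zero hd₀, zero_smul]

end LinearField

section Main

variable {k : Type*} [Field k] [CharZero k] {l n : ℕ}

theorem IsUnimodular.exists_gaugeEquiv_zero {D m : Module.End k (FormalFun k l n)}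
    {f : FormalFun k l n} (hmf : IsUnimodular D m f) (hD : IsVectorField 1 1 D) (hDD : D * D = 0)
    (hdiv : divergence 1 D = 0) (hn : 0 < n) :
    ∃ m', IsUnimodular D m' 0 ∧ GaugeEquiv D (m, f) (m', 0) := by
  obtain ⟨m', _, h⟩ := (isDivergenceSection_integralEven ⟨0, hn⟩).exists_gaugeEquiv hD hDD hdiv hmf
  exact ⟨m', h⟩

theorem IsUnimodular.exists_gaugeEquiv_smul_topMonomial {D m : Module.End k (FormalFun k l 0)}
    {f : FormalFun k l 0} (hmf : IsUnimodular D m f) (hD : IsVectorField 1 1 D) (hDD : D * D = 0)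
    (hdiv : divergence 1 D = 0) :
    ∃ (m' : Module.End k (FormalFun k l 0)) (c : k), IsUnimodular D m' (c • topMonomial k l 0) ∧
      GaugeEquiv D (m, f) (m', c • topMonomial k l 0) := by
  obtain ⟨s, hs⟩ := exists_isDivergenceSection_prod_eulerOdd (k := k) (n := 0) (List.finRange l)
  obtain ⟨m', u, h⟩ := hs.exists_gaugeEquiv hD hDD hdiv hmf
  obtain ⟨c, hc⟩ := exists_prod_eulerOdd_eq_smul_topMonomial u
  exact ⟨m', c, hc ▸ h⟩

end Main

end

end UnimodularLInfty

theorem theorem4p4_general {k : Type*} [Field k] [CharZero k] {l n : ℕ}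
    {D m : Module.End k (UnimodularLInfty.FormalFun k l n)} {f : UnimodularLInfty.FormalFun k l n}
    (hD : UnimodularLInfty.IsVectorField 1 1 D) (hDD : D * D = 0)
    (hdiv : UnimodularLInfty.divergence 1 D = 0) (hmf : UnimodularLInfty.IsUnimodular D m f) :
    ((0 < n ∨ Odd l) →
      ∃ m' : Module.End k (UnimodularLInfty.FormalFun k l n),
        UnimodularLInfty.IsUnimodular D m' 0 ∧
        UnimodularLInfty.GaugeEquiv D (m, f) (m', 0)) ∧
    (n = 0 →
      ∃ (m' : Module.End k (UnimodularLInfty.FormalFun k l n)) (c : k),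
        UnimodularLInfty.IsUnimodular D m' 0 ∧
        UnimodularLInfty.IsUnimodular D m' (c • UnimodularLInfty.topMonomial k l n) ∧
        UnimodularLInfty.GaugeEquiv D (m, f) (m', c • UnimodularLInfty.topMonomial k l n)) := by
  rcases Nat.eq_zero_or_pos n with rfl | hn
  · obtain ⟨m', c, hm', hequiv⟩ := hmf.exists_gaugeEquiv_smul_topMonomial hD hDD hdiv
    refine ⟨fun h => ?_, fun _ => ⟨m', c, hm'.zero_of_smul_topMonomial hD, hm', hequiv⟩⟩
    have hl : (l : ZMod 2) = 1 := ZMod.natCast_eq_one_iff_odd.mpr (h.resolve_left (lt_irrefl 0))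
    have hc : c • UnimodularLInfty.topMonomial k l 0 = 0 :=
      UnimodularLInfty.eq_zero_of_mem_parityPart_of_ne zero_ne_one hm'.even
        (hl ▸ Submodule.smul_mem _ c UnimodularLInfty.topMonomial_mem_parityPart)
    rw [hc] at hm' hequiv
    exact ⟨m', hm', hequiv⟩
  · exact ⟨fun _ => hmf.exists_gaugeEquiv_zero hD hDD hdiv hn, fun h => absurd h hn.ne'⟩

theorem theorem4p4 {k : Type*} [Field k] [CharZero k]
    {V₀ V₁ : Type*} [AddCommGroup V₀] [Module k V₀] [AddCommGroup V₁] [Module k V₁]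
    {l n : ℕ} (b₀ : Module.Basis (Fin l) k V₀) (b₁ : Module.Basis (Fin n) k V₁)
    (d₀ : V₀ →ₗ[k] V₁) (d₁ : V₁ →ₗ[k] V₀) (hd₀ : d₁ ∘ₗ d₀ = 0) (hd₁ : d₀ ∘ₗ d₁ = 0)
    (m : Module.End k (UnimodularLInfty.FormalFun k l n)) (f : UnimodularLInfty.FormalFun k l n)
    (hmf : UnimodularLInfty.IsUnimodular (UnimodularLInfty.linearField b₀ b₁ d₀ d₁) m f) :
    ((0 < n ∨ Odd l) →
      ∃ m' : Module.End k (UnimodularLInfty.FormalFun k l n),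
        UnimodularLInfty.IsUnimodular (UnimodularLInfty.linearField b₀ b₁ d₀ d₁) m' 0 ∧
        UnimodularLInfty.GaugeEquiv (UnimodularLInfty.linearField b₀ b₁ d₀ d₁) (m, f) (m', 0)) ∧
    ((n = 0 ∧ Even l) →
      ∃ (m' : Module.End k (UnimodularLInfty.FormalFun k l n)) (c : k),
        UnimodularLInfty.IsUnimodular (UnimodularLInfty.linearField b₀ b₁ d₀ d₁) m' 0 ∧
        UnimodularLInfty.IsUnimodular (UnimodularLInfty.linearField b₀ b₁ d₀ d₁) m'
          (c • UnimodularLInfty.topMonomial k l n) ∧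
        UnimodularLInfty.GaugeEquiv (UnimodularLInfty.linearField b₀ b₁ d₀ d₁) (m, f)
          (m', c • UnimodularLInfty.topMonomial k l n)) := by
  have h := theorem4p4_general (UnimodularLInfty.isVectorField_linearField b₀ b₁ d₀ d₁)
    (UnimodularLInfty.linearField_mul_self b₀ b₁ d₀ d₁ hd₀ hd₁)
    (UnimodularLInfty.divergence_linearField b₀ b₁ d₀ d₁) hmf
  exact ⟨h.1, fun hn => h.2 hn.1⟩
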